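/- **Lemma (Intensity measure of the crossing process).** Let $d\ge 3$, let $W\subset\mathbb R^d$ be a compact convex set with $\lambda_d(W)=1$, where $\lambda_n$ denotes $n$-dimensional Lebesgue measure, and let $L\subset\mathbb R^d$ be a two-dimensional linear subspace with orthogonal complement $L^\perp$. Write $v|_L$ and $A|_L$ for the orthogonal projections onto $L$ of a point $v$ and a set $A$, and $[v,w]$ for the segment between $v$ and $w$. Let $\delta_t>0$ $(t>0)$ satisfy $\delta_t\to0$ as $t\to\infty$. For $t>0$ let $V$ be the set of points of a Poisson point process on $W$ with intensity $t$ (intensity measure $t\,\lambda_d|_W$), let $S_t$ be the set of quadruples $(v_1,v_2,w_1,w_2)$ of pairwise distinct points of $V$ with $\|v_1-v_2\|\le\delta_t$, $\|w_1-w_2\|\le\delta_t$ and $[v_1,v_2]|_L\cap[w_1,w_2]|_L\ne\emptyset$, and for Borel sets $A\subset L$ put $$\xi_t(A)=\frac18\sum_{(v_1,v_2,w_1,w_2)\in S_t}\delta_{[v_1,v_2]|_L\cap[w_1,w_2]|_L}(A),\qquad \mathbf L_t(A)=\mathbb E\,\xi_t(A),$$ where $\delta_{\{x\}}$ is the unit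 mass at $x$ (almost surely every intersection occurring here is a single point). Let $B_d$ be the closed unit ball of $\mathbb R^d$, $B_2$ the closed unit disc of $L$, and $$c_d=\int_{2B_2}\int_{(B_d)^2}\mathbf 1\{[0,w_1]|_L\cap(w_3+[0,w_2]|_L)\neq\emptyset\}\,dw_1\,dw_2\,dw_3 .$$ Then $$c_d=2\pi\,\kappa_{d-2}^2\,\mathbf B\!\left(\tfrac32,\tfrac d2\right)^2,$$ where $\kappa_n$ is the volume of the $n$-dimensional unit ball and $\mathbf B$ is the beta function; and there are real numbers $g_t(A)$ and $c_t$ $(t>0$, $A\subset L$ Borel$)$ such that for all $t>0$ and all Borel sets $A\subset L$ the quantity $\xi_t(A)$ is a random variable (measurable up to null sets) with finite expectation, $$\mathbf L_t(A)=\frac18\,c_d\,t^4\,\delta_t^{2d+2}\left(\int_A\lambda_{d-2}\big((v+L^\perp)\cap W\big)^2\,dv+g_t(A)\right),$$ $$|g_t(A)|\le c_t,\qquad\text{and}\qquad c_t=\mathcal O(\delta_t)\ \text{ as } t\to\infty ,$$ where $g_t$ and $c_t$ depend only on $t$, $W$, $L$ and the function $t\mapsto\delta_t$ (and $g_t$ on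 $A$). -/

import Mathlib

open MeasureTheory ProbabilityTheory Filter Topology Asymptotics
open scoped ENNReal NNReal

noncomputable section

/-- A Poisson point process with intensity measure `μ`, as a random countable set of points:
the number of points in a measurable set `B` is a random variable, it is Poisson distributed with
mean `μ B` (and almost surely infinite if `μ B = ∞`), and the numbers of points in disjoint sets
are independent. The intensity measure is meant to be diffuse, so that the process is simple and
is the same thing as its support. -/
structure IsPoissonProcess {Ω X : Type*} [MeasurableSpace Ω] [MeasurableSpace X]
    (P : Measure Ω) (V : Ω → Set X) (μ : Measure X) : Prop where
  countable : ∀ ω, (V ω).Countable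
  measurable_count : ∀ B : Set X, MeasurableSet B → Measurable fun ω => (V ω ∩ B).encard
  law_count : ∀ B : Set X, MeasurableSet B → μ B ≠ ∞ →
    P.map (fun ω => (V ω ∩ B).encard) =
      (poissonMeasure (μ B).toNNReal).map (fun k : ℕ => (k : ℕ∞))
  count_eq_top : ∀ B : Set X, MeasurableSet B → μ B = ∞ →
    ∀ᵐ ω ∂P, (V ω ∩ B).encard = ⊤
  indep_count : ∀ (n : ℕ) (B : Fin n → Set X), (∀ i, MeasurableSet (B i)) →
    (∀ i j, i ≠ j → Disjoint (B i) (B j)) →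
    iIndepFun (fun (i : Fin n) (ω : Ω) => (V ω ∩ B i).encard) P

section Crossings

variable {d : ℕ} (L : Submodule ℝ (EuclideanSpace ℝ (Fin d)))

/-- The orthogonal projection onto `L` of the segment `[v, w]`, as a subset of `L`. -/
def projSegment (v w : EuclideanSpace ℝ (Fin d)) : Set L :=
  L.orthogonalProjectionOnto '' segment ℝ v w

/-- The set `[v₁, v₂]|_L ∩ [w₁, w₂]|_L` for the quadruple `q = (v₁, v₂, w₁, w₂)`. -/
def segmentCrossing (q : Fin 4 → EuclideanSpace ℝ (Fin d)) : Set L :=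
  projSegment L (q 0) (q 1) ∩ projSegment L (q 2) (q 3)

/-- The quadruples `(v₁, v₂, w₁, w₂)` of distinct points of `V` such that `{v₁, v₂}` and
`{w₁, w₂}` are edges of the geometric graph with radius `r` on `V` and cross in the projection
onto `L`. -/
def crossingQuadruples (r : ℝ) (V : Set (EuclideanSpace ℝ (Fin d))) :
    Set (Fin 4 → EuclideanSpace ℝ (Fin d)) :=
  {q | (∀ i, q i ∈ V) ∧ Function.Injective q ∧ ‖q 0 - q 1‖ ≤ r ∧ ‖q 2 - q 3‖ ≤ r ∧
    (segmentCrossing L q).Nonempty}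

/-- The crossing process of the geometric graph with vertex set `V` and radius `r`: one eighth of
the sum, over all crossing quadruples, of the unit mass at the crossing point. (Almost surely the
two projected segments meet in exactly one point; in the exceptional case of overlapping
segments the mass sits at some point of the intersection.) -/
def crossingProcess (r : ℝ) (V : Set (EuclideanSpace ℝ (Fin d))) : Measure L :=
  (8 : ℝ≥0∞)⁻¹ • Measure.sum fun q : crossingQuadruples L r V =>
    Measure.dirac (q.2.2.2.2.2.some : L)

/-- The expectation of the mass that the random measure `ξ` gives to `A`. -/
def intensity {Ω X : Type*} [MeasurableSpace Ω] [MeasurableSpace X]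
    (P : Measure Ω) (ξ : Ω → Measure X) (A : Set X) : ℝ≥0∞ :=
  ∫⁻ ω, ξ ω A ∂P

/-- The `(d - 2)`-dimensional volume `λ_{d-2}((v + Lᗮ) ∩ W)` of the slice of `W` above `v ∈ L`
(for a plane `L`). -/
def sliceVolume (W : Set (EuclideanSpace ℝ (Fin d))) (v : L) : ℝ :=
  (volume {y : Lᗮ | (v : EuclideanSpace ℝ (Fin d)) + (y : EuclideanSpace ℝ (Fin d)) ∈ W}).toReal

/-- The constant `c_d`, that is, the integral over `w₁, w₂` in the unit ball of `ℝᵈ` and `w₃` in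
the disc of radius `2` in `L` of the indicator that `[0, w₁]|_L` meets `w₃ + [0, w₂]|_L`. -/
def crossingConst : ℝ :=
  (volume {p : EuclideanSpace ℝ (Fin d) × EuclideanSpace ℝ (Fin d) × L |
    ‖p.1‖ ≤ 1 ∧ ‖p.2.1‖ ≤ 1 ∧ ‖p.2.2‖ ≤ 2 ∧
    (projSegment L 0 p.1 ∩ (fun x => p.2.2 + x) '' projSegment L 0 p.2.1).Nonempty}).toReal

end Crossings

/-- The volume `κ_n` of the `n`-dimensional Euclidean unit ball. -/
def unitBallVolume (n : ℕ) : ℝ :=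
  (volume (Metric.closedBall (0 : EuclideanSpace ℝ (Fin n)) 1)).toReal

end

/-!
The proof computes the expected number of crossing quadruples exactly as a Lebesgue volume and then
compares this volume with its leading term.

*Reduction to a volume.* The factorial moment formula `IsPoissonProcess.factorial_moment` states
that the expected number of `n`-tuples of distinct points in a set is its measure for the `n`-th
power of the intensity measure. It is proved from counts alone: both sides are measures carried by
the tuples with distinct entries, such tuples are covered by countably many boxes with disjoint
sides, and on those boxes independence applies. Quadruples with parallel projected segments form a
null set, so almost surely every crossing point is given by Cramer's rule, and the intensity measure
is `t ^ 4 / 8` times the volume of `crossingSet` in `W ^ 4` (`intensity_crossingProcess`).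

*The volume.* In a quadruple `(v, v + δ x, w, w + δ y)` with `w|_L = v|_L + δ z`, the crossing
condition depends only on the shape `(x, y, z)`; this substitution contributes the factor
`δ ^ (2 d + 2)` (`lintegral_quadruples`), and the volume of the crossing shapes is the constant
`crossingConst L`. For a fixed shape, the position is described by the crossing point `p ∈ L` and
by the two points `p + X`, `p + u` of the edges above it, with `X`, `u` in `Lᗮ`
(`lintegral_edgePair`). If both edges have their end points in the convex set `W`, then `p + X` and
`p + u` are in `W`; so the integral over `X`, `u` is at most the squared volume of the fibre of `W`
above `p`. Conversely the edges are in `W` as soon as `p + X` and `p + u` are in `W` and have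
distance more than `δ` from the complement of `W`. Hence the error is at most twice the largest
fibre volume times the volume of the boundary layer of width `δ`, which is `O(δ)` since `W` contains
a ball: the layer is outside a homothetic image of `W` with ratio `1 - δ / ρ`, and Bernoulli's
inequality applies (`exists_boundary_layer`).

*The constant.* For fixed `x` and `y` the admissible `z` form a parallelogram of area
`|det (x|_L, y|_L)|`. The projection of the uniform distribution on the unit ball has a rotation
invariant density, and polar coordinates split the integral into an angular part
`∫∫ |sin (θ - θ')| = 8 π` and the square of a radial part, which is a beta integral
(`volume_crossingShapes`).
-/


/-! ### Factorial moments of a Poisson process -/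

/-- The mean of the Poisson distribution. -/
theorem lintegral_natCast_poissonMeasure (r : ℝ≥0) :
    ∫⁻ k : ℕ, (k : ℝ≥0∞) ∂poissonMeasure r = r := by
  have hterm : ∀ k : ℕ, ENNReal.ofReal (Real.exp (-r) * r ^ (k + 1) / (k + 1).factorial) *
      ((k + 1 : ℕ) : ℝ≥0∞) = r * ENNReal.ofReal (Real.exp (-r) * r ^ k / k.factorial) := by
    intro k
    rw [← ENNReal.ofReal_natCast, ← ENNReal.ofReal_coe_nnreal, ← ENNReal.ofReal_mul (by positivity),
      ← ENNReal.ofReal_mul (by positivity)]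
    congr 1
    rw [Nat.factorial_succ]
    push_cast
    field_simp
    ring
  have hone : ∑' k : ℕ, ENNReal.ofReal (Real.exp (-r) * r ^ k / k.factorial) = 1 := by
    rw [← ENNReal.ofReal_tsum_of_nonneg (fun k => by positivity)
      (hasSum_one_poissonMeasure r).summable, (hasSum_one_poissonMeasure r).tsum_eq,
      ENNReal.ofReal_one]
  rw [poissonMeasure, lintegral_sum_measure]
  simp_rw [lintegral_smul_measure, lintegral_dirac]
  rw [tsum_eq_zero_add' ENNReal.summable]
  simp only [smul_eq_mul, hterm]
  rw [ENNReal.tsum_mul_left, hone]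
  simp

/-- The counting measure on the `n`-tuples of (not necessarily distinct) points of `V`. -/
noncomputable def tupleMeasure {X : Type*} [MeasurableSpace X] (n : ℕ) (V : Set X) :
    Measure (Fin n → X) :=
  Measure.count.restrict (Set.univ.pi fun _ => V)

theorem tupleMeasure_pi {X : Type*} [MeasurableSpace X] [MeasurableSingletonClass X] {n : ℕ}
    {V : Set X} (hV : V.Finite) {s : Fin n → Set X} (hs : ∀ i, MeasurableSet (s i)) :
    tupleMeasure n V (Set.univ.pi s) = ∏ i, ((V ∩ s i).encard : ℝ≥0∞) := by
  have hm : MeasurableSet (Set.univ.pi fun i => s i ∩ V) :=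
    .univ_pi fun i => (hs i).inter hV.measurableSet
  rw [tupleMeasure, Measure.restrict_apply (.univ_pi hs), ← Set.pi_inter_distrib,
    Measure.count_apply hm, Set.encard_pi_eq_prod_encard]
  simp only [← ENat.toENNRealRingHom_apply, map_prod, Set.inter_comm]

theorem isFiniteMeasure_tupleMeasure {X : Type*} [MeasurableSpace X] [MeasurableSingletonClass X]
    (n : ℕ) {V : Set X} (hV : V.Finite) : IsFiniteMeasure (tupleMeasure n V) := by
  constructor
  rw [tupleMeasure, Measure.restrict_apply_univ]
  exact Measure.count_apply_lt_top.2 (Set.Finite.pi fun _ => hV)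

/-- The random counting measure of `n`-tuples is measurable as soon as the counts of points in
measurable sets are: on boxes it is a product of such counts. -/
theorem measurable_tupleMeasure {Ω X : Type*} [MeasurableSpace Ω] [MeasurableSpace X]
    [MeasurableSingletonClass X] (n : ℕ) {V : Ω → Set X} (hV : ∀ ω, (V ω).Finite)
    (hmeas : ∀ B : Set X, MeasurableSet B → Measurable fun ω => (V ω ∩ B).encard) :
    Measurable fun ω => tupleMeasure n (V ω) := by
  have : ∀ ω, IsFiniteMeasure (tupleMeasure n (V ω)) :=
    fun ω => isFiniteMeasure_tupleMeasure n (hV ω)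
  have hbox : ∀ s : Fin n → Set X, (∀ i, MeasurableSet (s i)) →
      Measurable fun ω => tupleMeasure n (V ω) (Set.univ.pi s) := by
    intro s hs
    simp_rw [tupleMeasure_pi (hV _) hs]
    exact Finset.measurable_prod _ fun i _ => (Measurable.of_discrete).comp (hmeas _ (hs i))
  refine Measurable.measure_of_isPiSystem generateFrom_pi.symm isPiSystem_pi ?_ ?_
  · rintro _ ⟨s, hs, rfl⟩
    exact hbox s fun i => hs i (Set.mem_univ i)
  · simpa using hbox (fun _ => Set.univ) fun _ => .univ

/-- Injective tuples in a second countable Hausdorff space are covered by countably many boxes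
with pairwise disjoint measurable sides. -/
theorem exists_disjoint_boxes.{u} {X : Type u} [TopologicalSpace X] [T2Space X]
    [SecondCountableTopology X] [MeasurableSpace X] [OpensMeasurableSpace X] (n : ℕ) :
    ∃ (ι : Type u) (_ : Countable ι) (B : ι → Fin n → Set X),
      (∀ k i, MeasurableSet (B k i)) ∧ (∀ k i j, i ≠ j → Disjoint (B k i) (B k j)) ∧
      {q : Fin n → X | Function.Injective q} ⊆ ⋃ k, Set.univ.pi (B k) := by
  let b := TopologicalSpace.countableBasis X
  have : Countable b := (TopologicalSpace.countable_countableBasis X).to_subtype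
  refine ⟨{c : Fin n → b // ∀ i j, i ≠ j → Disjoint (c i : Set X) (c j : Set X)}, inferInstance,
    fun c i => c.1 i, fun c i => ?_, fun c => c.2, fun q hq => ?_⟩
  · exact (TopologicalSpace.isOpen_of_mem_countableBasis (c.1 i).2).measurableSet
  · have hd : Pairwise (Function.onFun Disjoint fun i => 𝓝 (q i)) :=
      fun i j hij => disjoint_nhds_nhds.2 (hq.ne hij)
    obtain ⟨s, hs, hsd⟩ := hd.exists_mem_filter_basis_of_disjoint
      fun i => (TopologicalSpace.isBasis_countableBasis X).nhds_hasBasis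
    refine Set.mem_iUnion.2 ⟨⟨fun i => ⟨s i, (hs i).1⟩, fun i j hij => hsd hij⟩, ?_⟩
    exact fun i _ => (hs i).2

theorem measurableSet_injective {X : Type*} [TopologicalSpace X] [T2Space X]
    [SecondCountableTopology X] [MeasurableSpace X] [BorelSpace X] (n : ℕ) :
    MeasurableSet {q : Fin n → X | Function.Injective q} := by
  have : {q : Fin n → X | Function.Injective q} = ⋂ i, ⋂ j, {q | q i = q j → i = j} := by
    ext q; simp [Function.Injective]
  rw [this]
  refine .iInter fun i => .iInter fun j => ?_
  by_cases hij : i = j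
  · simp [hij]
  · simp only [hij, imp_false]
    exact (measurableSet_eq_fun (measurable_pi_apply i) (measurable_pi_apply j)).compl

/-- The expected number of points of a Poisson process in a set. -/
theorem IsPoissonProcess.lintegral_encard {Ω X : Type*} [MeasurableSpace Ω] [MeasurableSpace X]
    {P : Measure Ω} {V : Ω → Set X} {μ : Measure X} [IsFiniteMeasure μ]
    (h : IsPoissonProcess P V μ) {B : Set X} (hB : MeasurableSet B) :
    ∫⁻ ω, ((V ω ∩ B).encard : ℝ≥0∞) ∂P = μ B := by
  have h1 : ∫⁻ ω, ((V ω ∩ B).encard : ℝ≥0∞) ∂P =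
      ∫⁻ k : ℕ∞, (k : ℝ≥0∞) ∂(P.map fun ω => (V ω ∩ B).encard) :=
    (lintegral_map .of_discrete (h.measurable_count B hB)).symm
  rw [h1, h.law_count B hB (measure_ne_top _ _), lintegral_map .of_discrete .of_discrete]
  simp [lintegral_natCast_poissonMeasure]

theorem IsPoissonProcess.ae_finite {Ω X : Type*} [MeasurableSpace Ω] [MeasurableSpace X]
    {P : Measure Ω} {V : Ω → Set X} {μ : Measure X} [IsFiniteMeasure μ]
    (h : IsPoissonProcess P V μ) : ∀ᵐ ω ∂P, (V ω).Finite := by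
  have hm : Measurable fun ω => ((V ω ∩ Set.univ).encard : ℝ≥0∞) :=
    (Measurable.of_discrete (f := fun k : ℕ∞ => (k : ℝ≥0∞))).comp (h.measurable_count _ .univ)
  have h1 := ae_lt_top hm (by rw [h.lintegral_encard .univ]; exact measure_ne_top _ _)
  filter_upwards [h1] with ω hω
  simpa [Set.encard_lt_top_iff] using hω

/-- **Factorial moments of a Poisson process.** The expected number of `n`-tuples of distinct
points that lie in a measurable set `C` is the `μⁿ`-measure of `C`. Both sides are measures in
`C` that are carried by the tuples with distinct entries, and they agree on the boxes with
disjoint sides by independence. -/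
theorem IsPoissonProcess.factorial_moment {Ω X : Type*} [MeasurableSpace Ω]
    [TopologicalSpace X] [T2Space X] [SecondCountableTopology X] [MeasurableSpace X] [BorelSpace X]
    {P : Measure Ω} [IsProbabilityMeasure P]
    {V : Ω → Set X} {μ : Measure X} [IsFiniteMeasure μ] (h : IsPoissonProcess P V μ) {n : ℕ}
    (hdiag : ∀ᵐ q ∂Measure.pi fun _ : Fin n => μ, Function.Injective q)
    {C : Set (Fin n → X)} (hC : MeasurableSet C) :
    AEMeasurable (fun ω => tupleMeasure n (V ω) (C ∩ {q | Function.Injective q})) P ∧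
      ∫⁻ ω, tupleMeasure n (V ω) (C ∩ {q | Function.Injective q}) ∂P =
        Measure.pi (fun _ => μ) C := by
  classical
  have hI := measurableSet_injective (X := X) n
  -- A modification of the process all of whose realizations are finite.
  let V' : Ω → Set X := fun ω => if (V ω ∩ Set.univ).encard < ⊤ then V ω else ∅
  have hVV' : ∀ᵐ ω ∂P, V ω = V' ω := by
    filter_upwards [h.ae_finite] with ω hω
    simp [V', hω]
  have hfin : ∀ ω, (V' ω).Finite := by
    intro ω
    by_cases hω : (V ω ∩ Set.univ).encard < ⊤
    · simp only [V', if_pos hω]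
      simpa [Set.encard_lt_top_iff] using hω
    · simp only [V', if_neg hω, Set.finite_empty]
  have hmeas : ∀ B : Set X, MeasurableSet B → Measurable fun ω => (V' ω ∩ B).encard := by
    intro B hB
    have : (fun ω => (V' ω ∩ B).encard) =
        fun ω => if (V ω ∩ Set.univ).encard < ⊤ then (V ω ∩ B).encard else 0 := by
      ext1 ω
      by_cases hω : (V ω ∩ Set.univ).encard < ⊤
      · simp only [V', if_pos hω]
      · simp only [V', if_neg hω, Set.empty_inter, Set.encard_empty]
    rw [this]
    exact Measurable.ite ((h.measurable_count _ .univ) (.of_discrete (s := Set.Iio ⊤)))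
      (h.measurable_count B hB) measurable_const
  have hκ := measurable_tupleMeasure n hfin hmeas
  have hae : ∀ᵐ ω ∂P, tupleMeasure n (V ω) (C ∩ {q | Function.Injective q}) =
      tupleMeasure n (V' ω) (C ∩ {q | Function.Injective q}) := by
    filter_upwards [hVV'] with ω hω
    rw [hω]
  refine ⟨⟨_, (Measure.measurable_coe (hC.inter hI)).comp hκ, hae⟩, ?_⟩
  rw [lintegral_congr_ae hae]
  have hbind : ∫⁻ ω, tupleMeasure n (V' ω) (C ∩ {q | Function.Injective q}) ∂P =
      (P.bind fun ω => tupleMeasure n (V' ω)) (C ∩ {q | Function.Injective q}) :=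
    (Measure.bind_apply (hC.inter hI) hκ.aemeasurable).symm
  rw [hbind]
  obtain ⟨ι, _, B, hBm, hBd, hBc⟩ := exists_disjoint_boxes (X := X) n
  have hbox : ∀ k, (P.bind fun ω => tupleMeasure n (V' ω)).restrict (Set.univ.pi (B k)) =
      (Measure.pi fun _ => μ).restrict (Set.univ.pi (B k)) := by
    intro k
    rw [Measure.restrict_pi_pi]
    refine (Measure.pi_eq fun s hs => ?_).symm
    rw [Measure.restrict_apply (.univ_pi hs), ← Set.pi_inter_distrib,
      Measure.bind_apply (.univ_pi fun i => (hs i).inter (hBm k i)) hκ.aemeasurable]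
    have h1 : ∀ᵐ ω ∂P, tupleMeasure n (V' ω) (Set.univ.pi fun i => s i ∩ B k i) =
        ∏ i, ((V ω ∩ (s i ∩ B k i)).encard : ℝ≥0∞) := by
      filter_upwards [hVV'] with ω hω
      rw [tupleMeasure_pi (hfin ω) fun i => (hs i).inter (hBm k i), hω]
    have hind := h.indep_count n (fun i => s i ∩ B k i) (fun i => (hs i).inter (hBm k i))
      fun i j hij => (hBd k i j hij).mono Set.inter_subset_right Set.inter_subset_right
    rw [lintegral_congr_ae h1, lintegral_prod_eq_prod_lintegral_of_indepFun Finset.univ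
      (fun i ω => ((V ω ∩ (s i ∩ B k i)).encard : ℝ≥0∞))
      (hind.comp (fun _ k => (k : ℝ≥0∞)) fun _ => .of_discrete)
      fun i => (Measurable.of_discrete (f := fun k : ℕ∞ => (k : ℝ≥0∞))).comp
        (h.measurable_count _ ((hs i).inter (hBm k i)))]
    refine Finset.prod_congr rfl fun i _ => ?_
    rw [h.lintegral_encard ((hs i).inter (hBm k i)), Measure.restrict_apply (hs i)]
  have hunion := Measure.restrict_congr_mono hBc (Measure.restrict_iUnion_congr.2 hbox)
  rw [← Measure.restrict_apply hC, hunion, Measure.restrict_apply hC]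
  refine measure_congr ?_
  filter_upwards [hdiag] with q hq
  simp only [eq_iff_iff]
  exact ⟨fun h => h.1, fun h => ⟨h, hq⟩⟩

/-! ### Crossings of segments in the plane -/

section Plane

variable {F : Type*} [NormedAddCommGroup F] [InnerProductSpace ℝ F]

/-- The signed area of the parallelogram spanned by two vectors `a`, `b` of a Euclidean plane,
computed in the coordinates given by an isometry `φ` onto `ℂ`. -/
noncomputable def planeDet (φ : F ≃ₗᵢ[ℝ] ℂ) (a b : F) : ℝ :=
  (φ a).re * (φ b).im - (φ a).im * (φ b).re

theorem continuous_planeDet (φ : F ≃ₗᵢ[ℝ] ℂ) : Continuous fun p : F × F => planeDet φ p.1 p.2 := by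
  have := φ.continuous
  unfold planeDet
  fun_prop

theorem planeDet_smul_smul (φ : F ≃ₗᵢ[ℝ] ℂ) (c : ℝ) (a b : F) :
    planeDet φ (c • a) (c • b) = c ^ 2 * planeDet φ a b := by
  simp only [planeDet, map_smul, Complex.smul_re, Complex.smul_im, smul_eq_mul]
  ring

/-- Cramer's rule for the intersection of two lines in a plane. -/
theorem smul_eq_add_smul_iff (φ : F ≃ₗᵢ[ℝ] ℂ) {a b z : F} (h : planeDet φ a b ≠ 0) (s r : ℝ) :
    s • a = z + r • b ↔
      s = planeDet φ z b / planeDet φ a b ∧ r = planeDet φ z a / planeDet φ a b := by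
  rw [eq_div_iff h, eq_div_iff h, ← φ.injective.eq_iff, Complex.ext_iff]
  simp only [planeDet, map_smul, map_add, Complex.smul_re, Complex.smul_im, Complex.add_re,
    Complex.add_im, smul_eq_mul] at h ⊢
  constructor
  · rintro ⟨h1, h2⟩
    exact ⟨by linear_combination (φ b).im * h1 - (φ b).re * h2,
      by linear_combination (φ a).im * h1 - (φ a).re * h2⟩
  · rintro ⟨h1, h2⟩
    exact ⟨mul_left_cancel₀ h (by linear_combination (φ a).re * h1 - (φ b).re * h2),
      mul_left_cancel₀ h (by linear_combination (φ a).im * h1 - (φ b).im * h2)⟩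

end Plane

section Crossings

variable {d : ℕ} {L : Submodule ℝ (EuclideanSpace ℝ (Fin d))}

theorem mem_projSegment_iff {v w : EuclideanSpace ℝ (Fin d)} {p : L} :
    p ∈ projSegment L v w ↔ ∃ s ∈ Set.Icc (0 : ℝ) 1,
      p = L.orthogonalProjectionOnto v + s • L.orthogonalProjectionOnto (w - v) := by
  rw [projSegment, segment_eq_image']
  simp only [Set.image_image, Set.mem_image, map_add, map_smul]
  exact exists_congr fun s => and_congr_right fun _ => eq_comm

/-- The determinant of the directions of the two projected segments of a quadruple. -/
noncomputable def crossingDet (φ : L ≃ₗᵢ[ℝ] ℂ) (q : Fin 4 → EuclideanSpace ℝ (Fin d)) : ℝ :=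
  planeDet φ (L.orthogonalProjectionOnto (q 1 - q 0)) (L.orthogonalProjectionOnto (q 3 - q 2))

/-- The position, along the first projected segment of a quadruple, of its intersection with the
line through the second one. -/
noncomputable def crossingParam₁ (φ : L ≃ₗᵢ[ℝ] ℂ) (q : Fin 4 → EuclideanSpace ℝ (Fin d)) : ℝ :=
  planeDet φ (L.orthogonalProjectionOnto (q 2 - q 0)) (L.orthogonalProjectionOnto (q 3 - q 2)) /
    crossingDet φ q

/-- The position, along the second projected segment of a quadruple, of its intersection with the
line through the first one. -/
noncomputable def crossingParam₂ (φ : L ≃ₗᵢ[ℝ] ℂ) (q : Fin 4 → EuclideanSpace ℝ (Fin d)) : ℝ :=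
  planeDet φ (L.orthogonalProjectionOnto (q 2 - q 0)) (L.orthogonalProjectionOnto (q 1 - q 0)) /
    crossingDet φ q

/-- The crossing point of the two projected segments of a quadruple in general position. -/
noncomputable def crossingPoint (φ : L ≃ₗᵢ[ℝ] ℂ) (q : Fin 4 → EuclideanSpace ℝ (Fin d)) : L :=
  L.orthogonalProjectionOnto (q 0) +
    crossingParam₁ φ q • L.orthogonalProjectionOnto (q 1 - q 0)

theorem mem_segmentCrossing_iff (φ : L ≃ₗᵢ[ℝ] ℂ) {q : Fin 4 → EuclideanSpace ℝ (Fin d)}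
    (hq : crossingDet φ q ≠ 0) {p : L} :
    p ∈ segmentCrossing L q ↔ crossingParam₁ φ q ∈ Set.Icc (0 : ℝ) 1 ∧
      crossingParam₂ φ q ∈ Set.Icc (0 : ℝ) 1 ∧ p = crossingPoint φ q := by
  have key := fun s r => smul_eq_add_smul_iff φ (a := L.orthogonalProjectionOnto (q 1 - q 0))
    (b := L.orthogonalProjectionOnto (q 3 - q 2)) (z := L.orthogonalProjectionOnto (q 2 - q 0))
    hq s r
  have hsub : L.orthogonalProjectionOnto (q 2 - q 0) =
    L.orthogonalProjectionOnto (q 2) - L.orthogonalProjectionOnto (q 0) := map_sub _ _ _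
  rw [segmentCrossing, Set.mem_inter_iff, mem_projSegment_iff, mem_projSegment_iff]
  constructor
  · rintro ⟨⟨s, hs, hps⟩, r, hr, hpr⟩
    have h1 := (key s r).1 (by rw [hsub, sub_add_eq_add_sub, eq_sub_iff_add_eq', ← hps, hpr])
    obtain ⟨rfl, rfl⟩ := h1
    exact ⟨hs, hr, hps⟩
  · rintro ⟨hs, hr, hp⟩
    refine ⟨⟨_, hs, hp⟩, _, hr, ?_⟩
    have h1 := (key (crossingParam₁ φ q) (crossingParam₂ φ q)).2 ⟨rfl, rfl⟩
    rw [hp, crossingPoint, h1, hsub]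
    abel

/-- The quadruples `(v₁, v₂, w₁, w₂)` such that `[v₁, v₂]` and `[w₁, w₂]` have length at most
`r`, project to segments that are not parallel, and cross in the projection at a point of `A`. -/
def crossingSet (φ : L ≃ₗᵢ[ℝ] ℂ) (r : ℝ) (A : Set L) : Set (Fin 4 → EuclideanSpace ℝ (Fin d)) :=
  {q | ‖q 0 - q 1‖ ≤ r ∧ ‖q 2 - q 3‖ ≤ r ∧ crossingDet φ q ≠ 0 ∧
    crossingParam₁ φ q ∈ Set.Icc (0 : ℝ) 1 ∧ crossingParam₂ φ q ∈ Set.Icc (0 : ℝ) 1 ∧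
    crossingPoint φ q ∈ A}

theorem measurable_planeDet_comp (φ : L ≃ₗᵢ[ℝ] ℂ) {X : Type*} [MeasurableSpace X] {f g : X → L}
    (hf : Measurable f) (hg : Measurable g) : Measurable fun x => planeDet φ (f x) (g x) :=
  (continuous_planeDet φ).measurable.comp (hf.prodMk hg)

theorem measurable_proj_sub (i j : Fin 4) :
    Measurable fun q : Fin 4 → EuclideanSpace ℝ (Fin d) =>
      L.orthogonalProjectionOnto (q i - q j) :=
  L.orthogonalProjectionOnto.continuous.measurable.comp
    ((measurable_pi_apply i).sub (measurable_pi_apply j))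

theorem measurable_crossingDet (φ : L ≃ₗᵢ[ℝ] ℂ) : Measurable (crossingDet φ) :=
  measurable_planeDet_comp φ (measurable_proj_sub 1 0) (measurable_proj_sub 3 2)

theorem measurable_crossingParam₁ (φ : L ≃ₗᵢ[ℝ] ℂ) : Measurable (crossingParam₁ φ) :=
  (measurable_planeDet_comp φ (measurable_proj_sub 2 0) (measurable_proj_sub 3 2)).div
    (measurable_crossingDet φ)

theorem measurable_crossingParam₂ (φ : L ≃ₗᵢ[ℝ] ℂ) : Measurable (crossingParam₂ φ) :=
  (measurable_planeDet_comp φ (measurable_proj_sub 2 0) (measurable_proj_sub 1 0)).div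
    (measurable_crossingDet φ)

theorem measurable_crossingPoint (φ : L ≃ₗᵢ[ℝ] ℂ) : Measurable (crossingPoint φ) :=
  (L.orthogonalProjectionOnto.continuous.measurable.comp (measurable_pi_apply 0)).add
    ((measurable_crossingParam₁ φ).smul (measurable_proj_sub 1 0))

theorem measurableSet_crossingSet (φ : L ≃ₗᵢ[ℝ] ℂ) (r : ℝ) {A : Set L} (hA : MeasurableSet A) :
    MeasurableSet (crossingSet φ r A) := by
  refine (measurableSet_le
    (((measurable_pi_apply 0).sub (measurable_pi_apply 1)).norm) measurable_const).inter
    ((measurableSet_le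
    (((measurable_pi_apply 2).sub (measurable_pi_apply 3)).norm) measurable_const).inter
    (((measurable_crossingDet φ) (measurableSet_singleton 0)).compl.inter
    (((measurable_crossingParam₁ φ) measurableSet_Icc).inter
    (((measurable_crossingParam₂ φ) measurableSet_Icc).inter ((measurable_crossingPoint φ) hA)))))

/-- If no quadruple of distinct points of `V` has parallel projected segments, then the crossing
process counts the quadruples in `crossingSet`. -/
theorem crossingProcess_apply (φ : L ≃ₗᵢ[ℝ] ℂ) (r : ℝ) {V : Set (EuclideanSpace ℝ (Fin d))}
    (hV : V.Countable)
    (hgen : ∀ q : Fin 4 → EuclideanSpace ℝ (Fin d), (∀ i, q i ∈ V) → Function.Injective q →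
      crossingDet φ q ≠ 0) {A : Set L} (hA : MeasurableSet A) :
    crossingProcess L r V A =
      8⁻¹ * tupleMeasure 4 V (crossingSet φ r A ∩ {q | Function.Injective q}) := by
  classical
  have hC : MeasurableSet (crossingSet φ r A ∩ {q | Function.Injective q}) :=
    (measurableSet_crossingSet φ r hA).inter (measurableSet_injective 4)
  have hpi : (Set.univ.pi fun _ : Fin 4 => V).Countable := Set.countable_univ_pi fun _ => hV
  rw [crossingProcess, Measure.smul_apply, Measure.sum_apply _ hA, smul_eq_mul, tupleMeasure,
    Measure.restrict_apply hC, Measure.count_apply (hC.inter hpi.measurableSet)]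
  congr 1
  have h1 : ∀ q : crossingQuadruples L r V, Measure.dirac (q.2.2.2.2.2.some : L) A =
      (crossingSet φ r A ∩ {q | Function.Injective q} ∩ Set.univ.pi fun _ => V).indicator
        (fun _ => (1 : ℝ≥0∞)) q.1 := by
    rintro ⟨q, hqV, hqi, h1, h2, h3⟩
    have hdet := hgen q hqV hqi
    obtain ⟨hs, hr, hp⟩ := (mem_segmentCrossing_iff φ hdet).1 h3.some_mem
    rw [Measure.dirac_apply' _ hA]
    by_cases hmem : h3.some ∈ A
    · rw [Set.indicator_of_mem hmem, Set.indicator_of_mem]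
      · rfl
      · exact ⟨⟨⟨h1, h2, hdet, hs, hr, hp ▸ hmem⟩, hqi⟩, fun i _ => hqV i⟩
    · rw [Set.indicator_of_notMem hmem, Set.indicator_of_notMem]
      exact fun h => hmem (hp ▸ h.1.1.2.2.2.2.2)
  rw [tsum_congr h1, ← ENNReal.tsum_set_one, tsum_subtype, tsum_subtype _ fun _ => (1 : ℝ≥0∞)]
  refine tsum_congr fun q => ?_
  by_cases hq : q ∈ crossingSet φ r A ∩ {q | Function.Injective q} ∩ Set.univ.pi fun _ => V
  · rw [Set.indicator_of_mem (s := crossingQuadruples L r V)]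
    obtain ⟨⟨⟨h1, h2, hdet, hs, hr, hp⟩, hqi⟩, hqV⟩ := hq
    exact ⟨fun i => hqV i (Set.mem_univ i), hqi, h1, h2, crossingPoint φ q,
      (mem_segmentCrossing_iff φ hdet).2 ⟨hs, hr, rfl⟩⟩
  · rw [Set.indicator_of_notMem hq, Set.indicator_apply_eq_zero]
    exact fun _ => Set.indicator_of_notMem hq _

end Crossings

/-! ### The mean area of a random parallelogram -/

/-- The set is the image of the unit square under the linear map `x + iy ↦ x a - y b`, whose
determinant is `-det (a, b)`. -/
theorem volume_setOf_smul_eq_add_smul_complex (a b : ℂ) :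
    volume {z : ℂ | ∃ s ∈ Set.Icc (0 : ℝ) 1, ∃ r ∈ Set.Icc (0 : ℝ) 1, s • a = z + r • b} =
      ENNReal.ofReal |a.re * b.im - a.im * b.re| := by
  let T : ℂ →ₗ[ℝ] ℂ := Matrix.toLin Complex.basisOneI Complex.basisOneI
    !![a.re, -b.re; a.im, -b.im]
  have hT : ∀ w : ℂ, T w = w.re • a - w.im • b := by
    intro w
    simp only [T, Matrix.toLin_apply, Matrix.mulVec, dotProduct, Fin.sum_univ_two]
    apply Complex.ext <;> simp <;> ring
  have himg : {z : ℂ | ∃ s ∈ Set.Icc (0 : ℝ) 1, ∃ r ∈ Set.Icc (0 : ℝ) 1, s • a = z + r • b} =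
      T '' (Complex.equivRealProd ⁻¹' (Set.Icc (0 : ℝ) 1 ×ˢ Set.Icc (0 : ℝ) 1)) := by
    ext z
    simp only [Set.mem_ofPred_eq, Set.mem_image, Set.mem_preimage, Set.mem_prod,
      Complex.equivRealProd_apply, hT]
    constructor
    · rintro ⟨s, hs, r, hr, h⟩
      exact ⟨⟨s, r⟩, ⟨hs, hr⟩, by simp only [h]; abel⟩
    · rintro ⟨w, ⟨hs, hr⟩, rfl⟩
      exact ⟨w.re, hs, w.im, hr, by abel⟩
  have hunit : volume (Complex.equivRealProd ⁻¹' (Set.Icc (0 : ℝ) 1 ×ˢ Set.Icc (0 : ℝ) 1)) = 1 := by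
    have h := Complex.volume_preserving_equiv_real_prod.measure_preimage
      (s := Set.Icc (0 : ℝ) 1 ×ˢ Set.Icc (0 : ℝ) 1)
      (measurableSet_Icc.prod measurableSet_Icc).nullMeasurableSet
    rw [Measure.volume_eq_prod, Measure.prod_prod] at h
    rw [Real.volume_Icc, sub_zero, ENNReal.ofReal_one, one_mul] at h
    exact h
  rw [himg, Measure.addHaar_image_linearMap, hunit, mul_one, LinearMap.det_toLin,
    Matrix.det_fin_two_of, ← abs_neg]
  congr 2
  ring

theorem lintegral_abs_sin_sub (α : ℝ) :
    ∫⁻ θ in Set.Ioo (-Real.pi) Real.pi, ENNReal.ofReal |Real.sin (θ - α)| = 4 := by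
  have hper : Function.Periodic (fun θ => |Real.sin θ|) (2 * Real.pi) :=
    fun θ => by simp only [Real.sin_add_two_pi]
  have hint : ∀ x y, IntervalIntegrable (fun θ => |Real.sin θ|) volume x y :=
    fun x y => Real.continuous_sin.abs.intervalIntegrable x y
  have h1 : ∫ θ in (0 : ℝ)..Real.pi, |Real.sin θ| = 2 := by
    have h : ∫ θ in (0 : ℝ)..Real.pi, |Real.sin θ| = ∫ θ in (0 : ℝ)..Real.pi, Real.sin θ := by
      refine intervalIntegral.integral_congr fun θ hθ => ?_
      rw [Set.uIcc_of_le Real.pi_pos.le] at hθ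
      exact abs_of_nonneg (Real.sin_nonneg_of_mem_Icc hθ)
    rw [h, integral_sin, Real.cos_zero, Real.cos_pi]
    norm_num
  have h2 : ∫ θ in Real.pi..(2 * Real.pi), |Real.sin θ| = 2 := by
    have := intervalIntegral.integral_comp_add_right (a := 0) (b := Real.pi)
      (fun θ => |Real.sin θ|) Real.pi
    simp only [Real.sin_add_pi, abs_neg, zero_add, ← two_mul] at this
    rw [← this, h1]
  have h3 : ∫ θ in (-Real.pi)..Real.pi, |Real.sin (θ - α)| = 4 := by
    rw [intervalIntegral.integral_comp_sub_right (fun θ => |Real.sin θ|)]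
    have := hper.intervalIntegral_add_eq (-Real.pi - α) 0
    rw [show -Real.pi - α + 2 * Real.pi = Real.pi - α by ring, zero_add,
      ← intervalIntegral.integral_add_adjacent_intervals (hint 0 Real.pi) (hint _ _), h1, h2]
      at this
    rw [this]
    norm_num
  have hcont : Continuous fun θ => |Real.sin (θ - α)| := by fun_prop
  rw [← ofReal_integral_eq_lintegral_ofReal
    (hcont.integrableOn_Icc.mono_set Set.Ioo_subset_Icc_self)
    (ae_of_all _ fun θ => abs_nonneg _), ← integral_Ioc_eq_integral_Ioo,
    ← intervalIntegral.integral_of_le (by linarith [Real.pi_pos]), h3]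
  norm_num

/-- Polar coordinates for a function of the radius and the angle that is a product. -/
theorem lintegral_complex_polar {f : ℝ → ℝ≥0∞} (hf : Measurable f) {g : ℝ → ℝ≥0∞}
    (hg : Measurable g) {F : ℂ → ℝ≥0∞}
    (hF : ∀ r θ : ℝ, 0 < r → F (Complex.polarCoord.symm (r, θ)) = f r * g θ) :
    ∫⁻ z, F z = (∫⁻ r in Set.Ioi (0 : ℝ), ENNReal.ofReal r * f r) *
      ∫⁻ θ in Set.Ioo (-Real.pi) Real.pi, g θ := by
  rw [← Complex.lintegral_comp_polarCoord_symm, polarCoord_target,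
    ← lintegral_prod_mul (by fun_prop) (by fun_prop), Measure.volume_eq_prod,
    Measure.prod_restrict]
  refine setLIntegral_congr_fun (measurableSet_Ioi.prod measurableSet_Ioo) fun p hp => ?_
  simp only [smul_eq_mul]
  rw [hF p.1 p.2 hp.1, mul_assoc]

/-- The mean area of a parallelogram spanned by two vectors with rotation invariant density. -/
theorem lintegral_lintegral_abs_det {f : ℝ → ℝ≥0∞} (hf : Measurable f) :
    ∫⁻ a : ℂ, ∫⁻ b : ℂ, f ‖a‖ * f ‖b‖ * ENNReal.ofReal |a.re * b.im - a.im * b.re| =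
      ENNReal.ofReal (8 * Real.pi) *
        (∫⁻ r in Set.Ioi (0 : ℝ), ENNReal.ofReal (r ^ 2) * f r) ^ 2 := by
  have hsq : ∀ g : ℝ → ℝ≥0∞, ∫⁻ r in Set.Ioi (0 : ℝ), ENNReal.ofReal r * (g r * ENNReal.ofReal r) =
      ∫⁻ r in Set.Ioi (0 : ℝ), ENNReal.ofReal (r ^ 2) * g r := by
    intro g
    refine setLIntegral_congr_fun measurableSet_Ioi fun r hr => ?_
    rw [pow_two, ENNReal.ofReal_mul (le_of_lt hr)]
    ring
  have hinner : ∀ a : ℂ, ∫⁻ b : ℂ, f ‖a‖ * f ‖b‖ * ENNReal.ofReal |a.re * b.im - a.im * b.re| =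
      f ‖a‖ * ENNReal.ofReal ‖a‖ *
        ((∫⁻ r in Set.Ioi (0 : ℝ), ENNReal.ofReal (r ^ 2) * f r) * 4) := by
    intro a
    rw [lintegral_complex_polar (f := fun r => f r * ENNReal.ofReal r)
      (g := fun θ => f ‖a‖ * ENNReal.ofReal ‖a‖ * ENNReal.ofReal |Real.sin (θ - a.arg)|)
      (by fun_prop) (by fun_prop), hsq, lintegral_const_mul _ (by fun_prop),
      lintegral_abs_sin_sub]
    · ring
    · intro r θ hr
      have hdet : a.re * (Complex.polarCoord.symm (r, θ)).im -
          a.im * (Complex.polarCoord.symm (r, θ)).re = r * (‖a‖ * Real.sin (θ - a.arg)) := by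
        rw [Real.sin_sub]
        simp only [Complex.polarCoord_symm_apply, Complex.re_ofReal_mul, Complex.im_ofReal_mul,
          Complex.add_re, Complex.add_im, Complex.I_re, Complex.I_im, Complex.ofReal_re,
          Complex.ofReal_im]
        linear_combination -(r * Real.sin θ) * Complex.norm_mul_cos_arg a +
          (r * Real.cos θ) * Complex.norm_mul_sin_arg a
      rw [hdet, Complex.norm_polarCoord_symm, abs_mul, abs_mul, abs_of_pos hr, abs_norm,
        ENNReal.ofReal_mul hr.le, ENNReal.ofReal_mul (norm_nonneg _)]
      ring
  simp_rw [hinner]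
  rw [lintegral_mul_const _ (by fun_prop), lintegral_complex_polar (f := fun r => f r *
    ENNReal.ofReal r) (g := fun _ => 1) (by fun_prop) (by fun_prop), hsq]
  · simp only [lintegral_const, Measure.restrict_apply_univ, Real.volume_Ioo, one_mul]
    rw [show Real.pi - -Real.pi = 2 * Real.pi by ring, show 8 * Real.pi = 4 * (2 * Real.pi) by ring,
      ENNReal.ofReal_mul (by norm_num)]
    norm_num
    ring
  · intro r θ hr
    rw [Complex.norm_polarCoord_symm, abs_of_pos hr, mul_one]

/-- The substitution `s = r ^ 2` turns the radial integral into a beta integral. -/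
theorem lintegral_sq_mul_sqrt_pow (n : ℕ) :
    ∫⁻ r in Set.Ioi (0 : ℝ), ENNReal.ofReal (r ^ 2) *
      (if r ≤ 1 then ENNReal.ofReal (√(1 - r ^ 2) ^ n) else 0) =
      ENNReal.ofReal (beta (3 / 2) ((n + 2) / 2) / 2) := by
  have hB : 0 < beta (3 / 2) (((n : ℝ) + 2) / 2) := beta_pos (by norm_num) (by positivity)
  have h1 := lintegral_betaPDF_eq_one (α := 3 / 2) (β := ((n : ℝ) + 2) / 2) (by norm_num)
    (by positivity)
  have himg : (fun r : ℝ => r ^ 2) '' Set.Ioo 0 1 = Set.Ioo 0 1 := by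
    ext s
    constructor
    · rintro ⟨r, hr, rfl⟩
      exact ⟨pow_pos hr.1 2, pow_lt_one₀ hr.1.le hr.2 two_ne_zero⟩
    · intro hs
      exact ⟨√s, ⟨Real.sqrt_pos.2 hs.1, by rw [Real.sqrt_lt' one_pos]; simpa using hs.2⟩,
        Real.sq_sqrt hs.1.le⟩
  have hinj : Set.InjOn (fun r : ℝ => r ^ 2) (Set.Ioo 0 1) :=
    fun x hx y hy h => (pow_left_inj₀ hx.1.le hy.1.le two_ne_zero).1 h
  rw [lintegral_betaPDF, ← himg, lintegral_image_eq_lintegral_abs_deriv_mul measurableSet_Ioo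
    (fun r _ => (hasDerivAt_pow 2 r).hasDerivWithinAt) hinj] at h1
  have h2 : ∀ r ∈ Set.Ioo (0 : ℝ) 1, ENNReal.ofReal |((2 : ℕ) : ℝ) * r ^ (2 - 1)| * ENNReal.ofReal
      (1 / beta (3 / 2) (((n : ℝ) + 2) / 2) * (r ^ 2) ^ ((3 / 2 : ℝ) - 1) *
        (1 - r ^ 2) ^ (((n : ℝ) + 2) / 2 - 1)) =
      ENNReal.ofReal (2 / beta (3 / 2) (((n : ℝ) + 2) / 2)) *
        (ENNReal.ofReal (r ^ 2) * ENNReal.ofReal (√(1 - r ^ 2) ^ n)) := by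
    intro r hr
    have hr2 : 0 ≤ 1 - r ^ 2 := by nlinarith [hr.1, hr.2]
    have e1 : (r ^ 2) ^ ((3 / 2 : ℝ) - 1) = r := by
      rw [show ((3 / 2 : ℝ) - 1) = 1 / 2 by norm_num, ← Real.sqrt_eq_rpow, Real.sqrt_sq hr.1.le]
    have e2 : (1 - r ^ 2) ^ (((n : ℝ) + 2) / 2 - 1) = √(1 - r ^ 2) ^ n := by
      rw [Real.sqrt_eq_rpow, ← Real.rpow_natCast ((1 - r ^ 2) ^ (1 / 2 : ℝ)), ← Real.rpow_mul hr2]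
      congr 1
      ring
    rw [e1, e2, ← ENNReal.ofReal_mul (abs_nonneg _), ← ENNReal.ofReal_mul (by positivity),
      ← ENNReal.ofReal_mul (by positivity)]
    congr 1
    rw [abs_of_nonneg (by have := hr.1.le; positivity)]
    push_cast
    ring
  rw [setLIntegral_congr_fun measurableSet_Ioo h2, lintegral_const_mul _ (by fun_prop)] at h1
  have h3 : ∫⁻ r in Set.Ioi (0 : ℝ), ENNReal.ofReal (r ^ 2) *
      (if r ≤ 1 then ENNReal.ofReal (√(1 - r ^ 2) ^ n) else 0) =
      ∫⁻ r in Set.Ioo (0 : ℝ) 1, ENNReal.ofReal (r ^ 2) * ENNReal.ofReal (√(1 - r ^ 2) ^ n) := by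
    rw [setLIntegral_congr (Ioo_ae_eq_Ioc (a := (0 : ℝ)) (b := 1)),
      ← Set.Ioi_inter_Iic, Set.inter_comm, ← Measure.restrict_restrict measurableSet_Iic,
      ← lintegral_indicator measurableSet_Iic]
    refine lintegral_congr fun r => ?_
    by_cases hr : r ≤ 1 <;> simp [hr]
  rw [h3]
  rw [ENNReal.eq_inv_of_mul_eq_one_left ((mul_comm _ _).trans h1),
    ← ENNReal.ofReal_inv_of_pos (by positivity), inv_div]

/-! ### The constant of the intensity measure -/

section Decomposition

variable {d : ℕ} (L : Submodule ℝ (EuclideanSpace ℝ (Fin d)))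

/-- Integration over the fibres of the orthogonal projection onto `L`. -/
theorem lintegral_eq_lintegral_add_orthogonal {f : EuclideanSpace ℝ (Fin d) → ℝ≥0∞}
    (hf : Measurable f) :
    ∫⁻ v, f v = ∫⁻ p : L, ∫⁻ u : Lᗮ, f ((p : EuclideanSpace ℝ (Fin d)) + u) := by
  have h1 : MeasurePreserving (fun x => WithLp.ofLp (L.orthogonalDecomposition x))
      (volume : Measure (EuclideanSpace ℝ (Fin d))) (volume : Measure (L × Lᗮ)) :=
    (WithLp.volume_preserving_ofLp _ _).comp L.orthogonalDecomposition.measurePreserving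
  have hm : Measurable fun q : L × Lᗮ => f ((q.1 : EuclideanSpace ℝ (Fin d)) + q.2) :=
    hf.comp (by fun_prop)
  have h2 := h1.lintegral_comp hm
  rw [Measure.volume_eq_prod, lintegral_prod _ hm.aemeasurable] at h2
  rw [← h2]
  refine lintegral_congr fun x => ?_
  simp

theorem projOnto_coe_add_orthogonal (p : L) (u : Lᗮ) :
    L.orthogonalProjectionOnto ((p : EuclideanSpace ℝ (Fin d)) + u) = p := by
  simp

theorem norm_sq_coe_add_orthogonal (p : L) (u : Lᗮ) :
    ‖(p : EuclideanSpace ℝ (Fin d)) + u‖ ^ 2 = ‖p‖ ^ 2 + ‖u‖ ^ 2 := by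
  rw [pow_two, norm_add_sq_eq_norm_sq_add_norm_sq_of_inner_eq_zero _ _
    (u.2 p.1 p.2)]
  simp [pow_two]

theorem volume_closedBall_orthogonal (hL : Module.finrank ℝ L = 2) (r : ℝ) (hr : 0 ≤ r) :
    volume (Metric.closedBall (0 : Lᗮ) r) =
      ENNReal.ofReal (r ^ (d - 2)) * ENNReal.ofReal (unitBallVolume (d - 2)) := by
  have hfin : Module.finrank ℝ Lᗮ = d - 2 := by
    have := L.finrank_add_finrank_orthogonal
    rw [hL, finrank_euclideanSpace_fin] at this
    omega
  have e : Lᗮ ≃ₗᵢ[ℝ] EuclideanSpace ℝ (Fin (d - 2)) :=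
    ((stdOrthonormalBasis ℝ Lᗮ).reindex (finCongr hfin)).repr
  have h1 : volume (Metric.closedBall (0 : Lᗮ) 1) =
      volume (Metric.closedBall (0 : EuclideanSpace ℝ (Fin (d - 2))) 1) := by
    rw [← e.measurePreserving.measure_preimage measurableSet_closedBall.nullMeasurableSet,
      e.preimage_closedBall, map_zero]
  rw [Measure.addHaar_closedBall' _ _ hr, h1, hfin, unitBallVolume, ENNReal.ofReal_toReal]
  exact (isCompact_closedBall _ _).measure_ne_top

/-- The fibre of the unit ball above `a ∈ L` is a ball of radius `√(1 - ‖a‖ ^ 2)` in `Lᗮ`. -/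
theorem lintegral_unitBall_comp_proj (hL : Module.finrank ℝ L = 2) {h : L → ℝ≥0∞}
    (hh : Measurable h) :
    ∫⁻ x in Metric.closedBall (0 : EuclideanSpace ℝ (Fin d)) 1, h (L.orthogonalProjectionOnto x) =
      ENNReal.ofReal (unitBallVolume (d - 2)) *
        ∫⁻ a, (if ‖a‖ ≤ 1 then ENNReal.ofReal (√(1 - ‖a‖ ^ 2) ^ (d - 2)) else 0) * h a := by
  have hm : Measurable fun a : L =>
      (if ‖a‖ ≤ 1 then ENNReal.ofReal (√(1 - ‖a‖ ^ 2) ^ (d - 2)) else 0) * h a :=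
    (Measurable.ite (measurableSet_le measurable_norm measurable_const) (by fun_prop)
      measurable_const).mul hh
  have hcomp : Measurable fun x => h (L.orthogonalProjectionOnto x) :=
    hh.comp L.orthogonalProjectionOnto.continuous.measurable
  rw [← lintegral_indicator measurableSet_closedBall, lintegral_eq_lintegral_add_orthogonal L
    (hcomp.indicator measurableSet_closedBall), ← lintegral_const_mul _ hm]
  refine lintegral_congr fun a => ?_
  have hset : ∀ u : Lᗮ, (Metric.closedBall (0 : EuclideanSpace ℝ (Fin d)) 1).indicator
      (fun x => h (L.orthogonalProjectionOnto x)) ((a : EuclideanSpace ℝ (Fin d)) + u) =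
      {u : Lᗮ | ‖a‖ ^ 2 + ‖u‖ ^ 2 ≤ 1}.indicator (fun _ => h a) u := by
    intro u
    classical
    rw [Set.indicator_apply, Set.indicator_apply, projOnto_coe_add_orthogonal,
      mem_closedBall_zero_iff, ← sq_le_one_iff₀ (norm_nonneg _), norm_sq_coe_add_orthogonal]
    rfl
  have hsm : MeasurableSet {u : Lᗮ | ‖a‖ ^ 2 + ‖u‖ ^ 2 ≤ 1} :=
    measurableSet_le (by fun_prop) measurable_const
  rw [lintegral_congr hset, lintegral_indicator_const hsm]
  by_cases ha : ‖a‖ ≤ 1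
  · have h1 : 0 ≤ 1 - ‖a‖ ^ 2 := by nlinarith [norm_nonneg a]
    have h2 : {u : Lᗮ | ‖a‖ ^ 2 + ‖u‖ ^ 2 ≤ 1} = Metric.closedBall 0 √(1 - ‖a‖ ^ 2) := by
      ext u
      rw [mem_closedBall_zero_iff, Real.le_sqrt (norm_nonneg _) h1, Set.mem_ofPred_eq]
      constructor <;> intro h <;> linarith
    rw [h2, volume_closedBall_orthogonal L hL _ (Real.sqrt_nonneg _), if_pos ha]
    ring
  · have h2 : {u : Lᗮ | ‖a‖ ^ 2 + ‖u‖ ^ 2 ≤ 1} = ∅ := by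
      ext u
      simp only [Set.mem_ofPred_eq, Set.mem_empty_iff_false, iff_false, not_le]
      nlinarith [sq_nonneg ‖u‖, not_le.1 ha]
    rw [h2, if_neg ha, measure_empty]
    simp

/-- The configurations `(x, y, z)` of two vectors of the unit ball and a translation in `L` for
which `[0, x]|_L` meets `z + [0, y]|_L`. The volume of this set is `crossingConst L`. -/
def crossingShapes : Set (EuclideanSpace ℝ (Fin d) × EuclideanSpace ℝ (Fin d) × L) :=
  {p | ‖p.1‖ ≤ 1 ∧ ‖p.2.1‖ ≤ 1 ∧ ∃ s ∈ Set.Icc (0 : ℝ) 1, ∃ r ∈ Set.Icc (0 : ℝ) 1,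
    s • L.orthogonalProjectionOnto p.1 = p.2.2 + r • L.orthogonalProjectionOnto p.2.1}

theorem crossingConst_eq : crossingConst L = (volume (crossingShapes L)).toReal := by
  rw [crossingConst]
  congr 2
  ext ⟨x, y, z⟩
  simp only [crossingShapes, Set.mem_ofPred_eq]
  refine and_congr_right fun hx => and_congr_right fun hy => ?_
  have hmem : (projSegment L 0 x ∩ (fun p => z + p) '' projSegment L 0 y).Nonempty ↔
      ∃ s ∈ Set.Icc (0 : ℝ) 1, ∃ r ∈ Set.Icc (0 : ℝ) 1,
        s • L.orthogonalProjectionOnto x = z + r • L.orthogonalProjectionOnto y := by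
    constructor
    · rintro ⟨p, hp, p', hp', hpp'⟩
      rw [mem_projSegment_iff] at hp hp'
      obtain ⟨s, hs, rfl⟩ := hp
      obtain ⟨r, hr, rfl⟩ := hp'
      exact ⟨s, hs, r, hr, by simpa using hpp'.symm⟩
    · rintro ⟨s, hs, r, hr, h⟩
      refine ⟨s • L.orthogonalProjectionOnto x, mem_projSegment_iff.2 ⟨s, hs, by simp⟩,
        r • L.orthogonalProjectionOnto y, mem_projSegment_iff.2 ⟨r, hr, by simp⟩, h.symm⟩
  rw [hmem]
  refine and_iff_right_of_imp ?_
  rintro ⟨s, hs, r, hr, h⟩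
  have hb : ∀ c ∈ Set.Icc (0 : ℝ) 1, ∀ v : EuclideanSpace ℝ (Fin d), ‖v‖ ≤ 1 →
      ‖c • L.orthogonalProjectionOnto v‖ ≤ 1 := by
    intro c hc v hv
    rw [norm_smul, Real.norm_of_nonneg hc.1]
    exact mul_le_one₀ hc.2 (norm_nonneg _) ((L.norm_orthogonalProjectionOnto_apply_le v).trans hv)
  rw [← sub_eq_iff_eq_add] at h
  rw [← h]
  exact (norm_sub_le _ _).trans (by linarith [hb s hs x hx, hb r hr y hy])

/-- The set is the image of a compact set of quadruples `(x, y, s, r)`. -/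
theorem isCompact_crossingShapes : IsCompact (crossingShapes L) := by
  have hK : IsCompact (Metric.closedBall (0 : EuclideanSpace ℝ (Fin d)) 1 ×ˢ
      Metric.closedBall (0 : EuclideanSpace ℝ (Fin d)) 1 ×ˢ Set.Icc (0 : ℝ) 1 ×ˢ
        Set.Icc (0 : ℝ) 1) :=
    (isCompact_closedBall _ _).prod ((isCompact_closedBall _ _).prod
      (isCompact_Icc.prod isCompact_Icc))
  convert hK.image (f := fun p => (p.1, p.2.1, p.2.2.1 • L.orthogonalProjectionOnto p.1 -
    p.2.2.2 • L.orthogonalProjectionOnto p.2.1)) (by fun_prop) using 1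
  ext ⟨x, y, z⟩
  simp only [crossingShapes, Set.mem_ofPred_eq, Set.mem_image, Set.mem_prod,
    mem_closedBall_zero_iff, Prod.mk.injEq, Prod.exists]
  constructor
  · rintro ⟨hx, hy, s, hs, r, hr, h⟩
    exact ⟨x, y, s, r, ⟨hx, hy, hs, hr⟩, rfl, rfl, by rw [h]; abel⟩
  · rintro ⟨x, y, s, r, ⟨hx, hy, hs, hr⟩, rfl, rfl, rfl⟩
    exact ⟨hx, hy, s, hs, r, hr, by abel⟩

variable {L}

theorem volume_setOf_smul_eq_add_smul (φ : L ≃ₗᵢ[ℝ] ℂ) (a b : L) :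
    volume {z : L | ∃ s ∈ Set.Icc (0 : ℝ) 1, ∃ r ∈ Set.Icc (0 : ℝ) 1, s • a = z + r • b} =
      ENNReal.ofReal |planeDet φ a b| := by
  rw [planeDet, ← volume_setOf_smul_eq_add_smul_complex,
    ← φ.measurePreserving.measure_preimage_emb φ.toHomeomorph.measurableEmbedding]
  congr 1
  ext z
  simp only [Set.mem_ofPred_eq, Set.mem_preimage, ← φ.map_smul, ← φ.map_add, φ.injective.eq_iff]

/-- The volume of the crossing configurations is the mean area of the parallelogram spanned by
the projections of two vectors of the unit ball. -/
theorem volume_crossingShapes_eq_lintegral (φ : L ≃ₗᵢ[ℝ] ℂ) :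
    volume (crossingShapes L) =
      ∫⁻ x in Metric.closedBall (0 : EuclideanSpace ℝ (Fin d)) 1,
        ∫⁻ y in Metric.closedBall (0 : EuclideanSpace ℝ (Fin d)) 1,
          ENNReal.ofReal |planeDet φ (L.orthogonalProjectionOnto x)
            (L.orthogonalProjectionOnto y)| := by
  have hm := (isCompact_crossingShapes L).measurableSet
  rw [Measure.volume_eq_prod, Measure.prod_apply hm,
    ← lintegral_indicator Metric.isClosed_closedBall.measurableSet]
  refine lintegral_congr fun x => ?_
  rw [Measure.volume_eq_prod, Measure.prod_apply (measurable_prodMk_left hm)]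
  by_cases hx : x ∈ Metric.closedBall (0 : EuclideanSpace ℝ (Fin d)) 1
  · rw [Set.indicator_of_mem hx, ← lintegral_indicator Metric.isClosed_closedBall.measurableSet]
    refine lintegral_congr fun y => ?_
    rw [mem_closedBall_zero_iff] at hx
    by_cases hy : y ∈ Metric.closedBall (0 : EuclideanSpace ℝ (Fin d)) 1
    · rw [Set.indicator_of_mem hy, ← volume_setOf_smul_eq_add_smul φ]
      rw [mem_closedBall_zero_iff] at hy
      congr 1
      ext z
      simp [crossingShapes, hx, hy]
    · rw [Set.indicator_of_notMem hy]
      rw [mem_closedBall_zero_iff] at hy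
      convert measure_empty (μ := (volume : Measure L))
      ext z
      simp [crossingShapes, hy]
  · rw [Set.indicator_of_notMem hx]
    rw [mem_closedBall_zero_iff] at hx
    convert lintegral_zero with y
    convert measure_empty (μ := (volume : Measure L))
    ext z
    simp [crossingShapes, hx]

theorem volume_crossingShapes (hL : Module.finrank ℝ L = 2) (hd : 2 ≤ d) (φ : L ≃ₗᵢ[ℝ] ℂ) :
    volume (crossingShapes L) = ENNReal.ofReal
      (2 * Real.pi * unitBallVolume (d - 2) ^ 2 * beta (3 / 2) (d / 2) ^ 2) := by
  let f : ℝ → ℝ≥0∞ := fun r => if r ≤ 1 then ENNReal.ofReal (√(1 - r ^ 2) ^ (d - 2)) else 0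
  have hf : Measurable f :=
    Measurable.ite measurableSet_Iic (by fun_prop) measurable_const
  have hdet : Measurable fun p : L × L => ENNReal.ofReal |planeDet φ p.1 p.2| :=
    (continuous_planeDet φ).abs.measurable.ennreal_ofReal
  have hφ : ∀ F : ℂ → ℝ≥0∞, ∫⁻ z, F z = ∫⁻ a, F (φ a) := fun F =>
    (φ.measurePreserving.lintegral_comp_emb φ.toHomeomorph.measurableEmbedding F).symm
  have hdeta : ∀ a : L, Measurable fun b : L => ENNReal.ofReal |planeDet φ a b| := fun a =>
    ((continuous_planeDet φ).comp (Continuous.prodMk_right a)).abs.measurable.ennreal_ofReal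
  have h1 : ∀ a : L, ∫⁻ y in Metric.closedBall (0 : EuclideanSpace ℝ (Fin d)) 1,
      ENNReal.ofReal |planeDet φ a (L.orthogonalProjectionOnto y)| =
      ENNReal.ofReal (unitBallVolume (d - 2)) *
        ∫⁻ b : L, f ‖b‖ * ENNReal.ofReal |planeDet φ a b| :=
    fun a => lintegral_unitBall_comp_proj L hL (hdeta a)
  have h2 : Measurable fun a : L => ∫⁻ b : L, f ‖b‖ * ENNReal.ofReal |planeDet φ a b| :=
    Measurable.lintegral_prod_right' ((hf.comp measurable_snd.norm).mul hdet)
  rw [volume_crossingShapes_eq_lintegral φ]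
  simp_rw [h1]
  rw [lintegral_unitBall_comp_proj L hL (h2.const_mul _)]
  have h3 : ∫⁻ a : L, f ‖a‖ * (ENNReal.ofReal (unitBallVolume (d - 2)) *
      ∫⁻ b : L, f ‖b‖ * ENNReal.ofReal |planeDet φ a b|) =
      ENNReal.ofReal (unitBallVolume (d - 2)) * ∫⁻ a : ℂ, ∫⁻ b : ℂ,
        f ‖a‖ * f ‖b‖ * ENNReal.ofReal |a.re * b.im - a.im * b.re| := by
    rw [hφ fun a => ∫⁻ b : ℂ, f ‖a‖ * f ‖b‖ * ENNReal.ofReal |a.re * b.im - a.im * b.re|,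
      ← lintegral_const_mul' _ _ ENNReal.ofReal_ne_top]
    refine lintegral_congr fun a => ?_
    have h : Measurable fun b : L => f ‖b‖ * ENNReal.ofReal |planeDet φ a b| :=
      (hf.comp measurable_norm).mul (hdeta a)
    rw [hφ fun b => f ‖φ a‖ * f ‖b‖ * ENNReal.ofReal |(φ a).re * b.im - (φ a).im * b.re|,
      mul_left_comm, ← lintegral_const_mul _ h]
    simp only [φ.norm_map, planeDet, mul_assoc]
  have h4 : (0 : ℝ) ≤ unitBallVolume (d - 2) := ENNReal.toReal_nonneg
  have h5 : 0 < beta (3 / 2) ((d : ℝ) / 2) := beta_pos (by norm_num) (by positivity)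
  have h6 := lintegral_sq_mul_sqrt_pow (d - 2)
  rw [show (((d - 2 : ℕ) : ℝ) + 2) / 2 = (d : ℝ) / 2 by push_cast [hd]; ring] at h6
  rw [h3, lintegral_lintegral_abs_det hf, h6, ← ENNReal.ofReal_pow (by positivity),
    ← ENNReal.ofReal_mul (by positivity), ← ENNReal.ofReal_mul h4, ← ENNReal.ofReal_mul h4]
  congr 1
  ring

end Decomposition

/-! ### The integral over quadruples -/

/-- Substitution `v = a + δ x` in a finite-dimensional space. -/
theorem lintegral_eq_mul_lintegral_add_smul {F : Type*} [NormedAddCommGroup F] [NormedSpace ℝ F]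
    [FiniteDimensional ℝ F] [MeasurableSpace F] [BorelSpace F] (μ : Measure F) [μ.IsAddHaarMeasure]
    {f : F → ℝ≥0∞} (hf : Measurable f) (a : F) {δ : ℝ} (hδ : 0 < δ) :
    ∫⁻ v, f v ∂μ = ENNReal.ofReal (δ ^ Module.finrank ℝ F) * ∫⁻ x, f (a + δ • x) ∂μ := by
  have h1 : ∫⁻ x, f (a + δ • x) ∂μ = ∫⁻ v, f (a + v) ∂(μ.map (δ • ·)) :=
    (lintegral_map (f := fun v => f (a + v)) (hf.comp (measurable_const_add a))
      (measurable_const_smul δ)).symm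
  rw [h1, Measure.map_addHaar_smul _ hδ.ne', lintegral_smul_measure, smul_eq_mul, ← mul_assoc,
    ← ENNReal.ofReal_mul (by positivity), abs_of_nonneg (by positivity),
    mul_inv_cancel₀ (by positivity), ENNReal.ofReal_one, one_mul,
    lintegral_add_left_eq_self]

/-- Fubini for quadruples, with the base points `q 0`, `q 2` of the two edges integrated last. -/
theorem lintegral_pi_fin_four {X : Type*} [MeasurableSpace X] (μ : Measure X) [SigmaFinite μ]
    {f : (Fin 4 → X) → ℝ≥0∞} (hf : Measurable f) :
    ∫⁻ q, f q ∂Measure.pi (fun _ => μ) =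
      ∫⁻ p, ∫⁻ p', f ![p.1, p'.1, p.2, p'.2] ∂μ.prod μ ∂μ.prod μ := by
  have hT : Measurable fun p : (X × X) × X × X => ![p.1.1, p.2.1, p.1.2, p.2.2] := by
    refine measurable_pi_iff.2 fun i => ?_
    fin_cases i <;> simp <;> fun_prop
  have hmap : Measure.pi (fun _ : Fin 4 => μ) = ((μ.prod μ).prod (μ.prod μ)).map
      fun p => ![p.1.1, p.2.1, p.1.2, p.2.2] := by
    refine Measure.pi_eq fun s hs => ?_
    rw [Measure.map_apply hT (.univ_pi hs)]
    have : (fun p : (X × X) × X × X => ![p.1.1, p.2.1, p.1.2, p.2.2]) ⁻¹' Set.univ.pi s =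
        (s 0 ×ˢ s 2) ×ˢ s 1 ×ˢ s 3 := by
      ext p
      simp [Fin.forall_fin_succ]
      tauto
    rw [this, Measure.prod_prod, Measure.prod_prod, Measure.prod_prod, Fin.prod_univ_four]
    ring
  rw [hmap, lintegral_map hf hT, lintegral_prod _ (by exact (hf.comp hT).aemeasurable)]

section Fibres

variable {d : ℕ} {L : Submodule ℝ (EuclideanSpace ℝ (Fin d))}

/-- The quadruple whose edges are `[v, v + δ x]` and `[w, w + δ y]`, where `w` has components
`v|_L + δ z` and `u` in `L` and `Lᗮ`. -/
noncomputable def edgePair (δ : ℝ) (x y : EuclideanSpace ℝ (Fin d)) (z : L)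
    (v : EuclideanSpace ℝ (Fin d)) (u : Lᗮ) : Fin 4 → EuclideanSpace ℝ (Fin d) :=
  ![v, v + δ • x, ((L.orthogonalProjectionOnto v + δ • z : L) : EuclideanSpace ℝ (Fin d)) + u,
    ((L.orthogonalProjectionOnto v + δ • z : L) : EuclideanSpace ℝ (Fin d)) + u + δ • y]

theorem measurable_edgePair (δ : ℝ) :
    Measurable fun p : (EuclideanSpace ℝ (Fin d) × EuclideanSpace ℝ (Fin d)) × L ×
      EuclideanSpace ℝ (Fin d) × Lᗮ => edgePair δ p.1.1 p.1.2 p.2.1 p.2.2.1 p.2.2.2 := by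
  have h : Measurable fun p : (EuclideanSpace ℝ (Fin d) × EuclideanSpace ℝ (Fin d)) × L ×
      EuclideanSpace ℝ (Fin d) × Lᗮ => L.orthogonalProjectionOnto p.2.2.1 :=
    L.orthogonalProjectionOnto.continuous.measurable.comp (by fun_prop)
  refine measurable_pi_iff.2 fun i => ?_
  fin_cases i <;> simp [edgePair] <;> fun_prop

/-- The edge vectors and the projected difference of the base points are rescaled by `δ`; these
are `d + d + 2` coordinates. -/
theorem lintegral_quadruples (hL : Module.finrank ℝ L = 2)
    {f : (Fin 4 → EuclideanSpace ℝ (Fin d)) → ℝ≥0∞} (hf : Measurable f) {δ : ℝ} (hδ : 0 < δ) :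
    ∫⁻ q, f q = ENNReal.ofReal (δ ^ (2 * d + 2)) *
      ∫⁻ p : EuclideanSpace ℝ (Fin d) × EuclideanSpace ℝ (Fin d), ∫⁻ z : L,
        ∫⁻ v, ∫⁻ u : Lᗮ, f (edgePair δ p.1 p.2 z v u) := by
  let E := EuclideanSpace ℝ (Fin d)
  have hT : Measurable fun p : (E × E) × E × E => f ![p.1.1, p.2.1, p.1.2, p.2.2] := by
    refine hf.comp (measurable_pi_iff.2 fun i => ?_)
    fin_cases i <;> simp <;> fun_prop
  have hS : Measurable fun p : (E × E) × E × E =>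
      f ![p.1.1, p.1.1 + δ • p.2.1, p.1.2, p.1.2 + δ • p.2.2] := by
    refine hf.comp (measurable_pi_iff.2 fun i => ?_)
    fin_cases i <;> simp <;> fun_prop
  have hU : Measurable fun p : (E × E) × L × E × Lᗮ =>
      f (edgePair δ p.1.1 p.1.2 p.2.1 p.2.2.1 p.2.2.2) := hf.comp (measurable_edgePair δ)
  have hfin : Module.finrank ℝ (E × E) = 2 * d := by
    rw [Module.finrank_prod, finrank_euclideanSpace_fin, two_mul]
  have hHaar : (volume : Measure (E × E)).IsAddHaarMeasure := by
    rw [Measure.volume_eq_prod]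
    infer_instance
  have h1 : ∀ p : E × E, ∫⁻ p' : E × E, f ![p.1, p'.1, p.2, p'.2] =
      ENNReal.ofReal (δ ^ (2 * d)) * ∫⁻ ξ : E × E, f ![p.1, p.1 + δ • ξ.1, p.2, p.2 + δ • ξ.2] := by
    intro p
    have hTp : Measurable fun p' : E × E => f ![p.1, p'.1, p.2, p'.2] :=
      hT.comp measurable_prodMk_left
    rw [lintegral_eq_mul_lintegral_add_smul volume hTp p hδ, hfin]
    rfl
  have h2 : ∀ ξ : E × E, ∫⁻ p : E × E, f ![p.1, p.1 + δ • ξ.1, p.2, p.2 + δ • ξ.2] =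
      ENNReal.ofReal (δ ^ 2) * ∫⁻ z : L, ∫⁻ v, ∫⁻ u : Lᗮ, f (edgePair δ ξ.1 ξ.2 z v u) := by
    intro ξ
    have hp : Measurable fun p : E × E => f ![p.1, p.1 + δ • ξ.1, p.2, p.2 + δ • ξ.2] :=
      hS.comp measurable_prodMk_right
    rw [Measure.volume_eq_prod, lintegral_prod _ hp.aemeasurable]
    have h3 : ∀ v : E, ∫⁻ w : E, f ![v, v + δ • ξ.1, w, w + δ • ξ.2] =
        ENNReal.ofReal (δ ^ 2) * ∫⁻ z : L, ∫⁻ u : Lᗮ, f (edgePair δ ξ.1 ξ.2 z v u) := by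
      intro v
      have hw : Measurable fun w : E => f ![v, v + δ • ξ.1, w, w + δ • ξ.2] :=
        hp.comp measurable_prodMk_left
      have hw2 : Measurable fun p : L × Lᗮ =>
          f ![v, v + δ • ξ.1, (p.1 : E) + p.2, (p.1 : E) + p.2 + δ • ξ.2] :=
        hw.comp (by fun_prop)
      rw [lintegral_eq_lintegral_add_orthogonal L hw,
        lintegral_eq_mul_lintegral_add_smul volume hw2.lintegral_prod_right'
          (L.orthogonalProjectionOnto v) hδ, hL]
      rfl
    refine (lintegral_congr h3).trans ?_
    have hvz : Measurable fun p : E × L => ∫⁻ u : Lᗮ, f (edgePair δ ξ.1 ξ.2 p.2 p.1 u) := by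
      have : Measurable fun p : (E × L) × Lᗮ => f (edgePair δ ξ.1 ξ.2 p.1.2 p.1.1 p.2) :=
        hU.comp (f := fun p : (E × L) × Lᗮ => (ξ, p.1.2, p.1.1, p.2)) (by fun_prop)
      exact this.lintegral_prod_right'
    rw [lintegral_const_mul _ hvz.lintegral_prod_right',
      lintegral_lintegral_swap hvz.aemeasurable]
  rw [volume_pi, lintegral_pi_fin_four volume hf, ← Measure.volume_eq_prod]
  rw [lintegral_congr h1, lintegral_const_mul _ hS.lintegral_prod_right',
    lintegral_lintegral_swap hS.aemeasurable, lintegral_congr h2]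
  rw [lintegral_const_mul', ← mul_assoc, ← ENNReal.ofReal_mul (by positivity), ← pow_add]
  exact ENNReal.ofReal_ne_top

/-- The volume of the fibre of `S` above `p ∈ L`. -/
noncomputable def fibreVolume (S : Set (EuclideanSpace ℝ (Fin d))) (p : L) : ℝ≥0∞ :=
  volume {u : Lᗮ | (p : EuclideanSpace ℝ (Fin d)) + u ∈ S}

theorem measurableSet_fibre {S : Set (EuclideanSpace ℝ (Fin d))} (hS : MeasurableSet S) :
    MeasurableSet {p : L × Lᗮ | (p.1 : EuclideanSpace ℝ (Fin d)) + p.2 ∈ S} :=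
  (show Measurable fun p : L × Lᗮ => (p.1 : EuclideanSpace ℝ (Fin d)) + p.2 by fun_prop) hS

theorem measurableSet_fibre_section {S : Set (EuclideanSpace ℝ (Fin d))} (hS : MeasurableSet S)
    (p : L) : MeasurableSet {u : Lᗮ | (p : EuclideanSpace ℝ (Fin d)) + u ∈ S} :=
  measurable_prodMk_left (measurableSet_fibre hS)

theorem measurable_fibreVolume {S : Set (EuclideanSpace ℝ (Fin d))} (hS : MeasurableSet S) :
    Measurable (fibreVolume (L := L) S) :=
  measurable_measure_prodMk_left (measurableSet_fibre hS)

theorem lintegral_fibreVolume {S : Set (EuclideanSpace ℝ (Fin d))} (hS : MeasurableSet S) :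
    ∫⁻ p : L, fibreVolume S p = volume S := by
  rw [← lintegral_indicator_one hS, lintegral_eq_lintegral_add_orthogonal L
    (measurable_one.indicator hS)]
  refine lintegral_congr fun p => ?_
  rw [fibreVolume, ← lintegral_indicator_one (measurableSet_fibre_section hS p)]
  rfl

theorem fibreVolume_mono {S T : Set (EuclideanSpace ℝ (Fin d))} (h : S ⊆ T) (p : L) :
    fibreVolume S p ≤ fibreVolume T p :=
  measure_mono fun _ hu => h hu

theorem fibreVolume_union_le (S T : Set (EuclideanSpace ℝ (Fin d))) (p : L) :
    fibreVolume (S ∪ T) p ≤ fibreVolume S p + fibreVolume T p :=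
  measure_union_le _ _

/-- For edges of the form `edgePair` the crossing condition depends on the shape `(x, y, z)` only,
and the crossing point is the projection of a point of the first edge. -/
theorem edgePair_mem_crossingSet_iff (φ : L ≃ₗᵢ[ℝ] ℂ) {δ : ℝ} (hδ : 0 < δ)
    {x y : EuclideanSpace ℝ (Fin d)}
    (hxy : planeDet φ (L.orthogonalProjectionOnto x) (L.orthogonalProjectionOnto y) ≠ 0) {z : L}
    {v : EuclideanSpace ℝ (Fin d)} {u : Lᗮ} {A : Set L} :
    edgePair δ x y z v u ∈ crossingSet φ δ A ↔ ‖x‖ ≤ 1 ∧ ‖y‖ ≤ 1 ∧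
      ∃ s ∈ Set.Icc (0 : ℝ) 1, ∃ r ∈ Set.Icc (0 : ℝ) 1,
        s • L.orthogonalProjectionOnto x = z + r • L.orthogonalProjectionOnto y ∧
        L.orthogonalProjectionOnto (v + (s * δ) • x) ∈ A := by
  have e0 : edgePair δ x y z v u 1 - edgePair δ x y z v u 0 = δ • x := by simp [edgePair]
  have e1 : edgePair δ x y z v u 3 - edgePair δ x y z v u 2 = δ • y := by simp [edgePair]
  have e2 : L.orthogonalProjectionOnto (edgePair δ x y z v u 2 - edgePair δ x y z v u 0) =
      δ • z := by
    rw [map_sub]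
    simp only [edgePair, Matrix.cons_val, projOnto_coe_add_orthogonal]
    abel
  have hnorm : ∀ w : EuclideanSpace ℝ (Fin d), ‖δ • w‖ ≤ δ ↔ ‖w‖ ≤ 1 := by
    intro w
    rw [norm_smul, Real.norm_of_nonneg hδ.le, mul_le_iff_le_one_right hδ]
  have hδ2 : δ ^ 2 ≠ 0 := by positivity
  have hdet : crossingDet φ (edgePair δ x y z v u) =
      δ ^ 2 * planeDet φ (L.orthogonalProjectionOnto x) (L.orthogonalProjectionOnto y) := by
    rw [crossingDet, e0, e1, map_smul, map_smul, planeDet_smul_smul]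
  have hp1 : crossingParam₁ φ (edgePair δ x y z v u) =
      planeDet φ z (L.orthogonalProjectionOnto y) /
        planeDet φ (L.orthogonalProjectionOnto x) (L.orthogonalProjectionOnto y) := by
    rw [crossingParam₁, hdet, e1, e2, map_smul, planeDet_smul_smul, mul_div_mul_left _ _ hδ2]
  have hp2 : crossingParam₂ φ (edgePair δ x y z v u) =
      planeDet φ z (L.orthogonalProjectionOnto x) /
        planeDet φ (L.orthogonalProjectionOnto x) (L.orthogonalProjectionOnto y) := by
    rw [crossingParam₂, hdet, e0, e2, map_smul, planeDet_smul_smul, mul_div_mul_left _ _ hδ2]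
  have hpt : crossingPoint φ (edgePair δ x y z v u) =
      L.orthogonalProjectionOnto (v + (crossingParam₁ φ (edgePair δ x y z v u) * δ) • x) := by
    rw [crossingPoint, e0, map_add, ← smul_smul, map_smul _ (crossingParam₁ φ _)]
    rfl
  simp only [crossingSet, Set.mem_ofPred_eq]
  rw [norm_sub_rev, e0, norm_sub_rev, e1, hnorm, hnorm, hpt, hp1, hp2, hdet]
  refine and_congr_right fun _ => and_congr_right fun _ => ?_
  have key := fun s r => smul_eq_add_smul_iff φ (z := z) hxy s r
  constructor
  · rintro ⟨-, hs, hr, hA⟩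
    exact ⟨_, hs, _, hr, (key _ _).2 ⟨rfl, rfl⟩, hA⟩
  · rintro ⟨s, hs, r, hr, h, hA⟩
    obtain ⟨rfl, rfl⟩ := (key s r).1 h
    exact ⟨mul_ne_zero hδ2 hxy, hs, hr, hA⟩

/-- The positions of a point `X` of the segment `[X - s x, X + (1 - s) x]` for which both end
points belong to `W`. -/
def segmentPositions (W : Set (EuclideanSpace ℝ (Fin d))) (s : ℝ) (x : EuclideanSpace ℝ (Fin d)) :
    Set (EuclideanSpace ℝ (Fin d)) :=
  {X | X - s • x ∈ W ∧ X - s • x + x ∈ W}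

theorem measurableSet_segmentPositions {W : Set (EuclideanSpace ℝ (Fin d))} (hW : MeasurableSet W)
    (s : ℝ) (x : EuclideanSpace ℝ (Fin d)) : MeasurableSet (segmentPositions W s x) :=
  ((measurable_id.sub_const _) hW).inter (((measurable_id.sub_const _).add_const _) hW)

theorem segmentPositions_subset {W : Set (EuclideanSpace ℝ (Fin d))} (hW : Convex ℝ W) {s : ℝ}
    (hs : s ∈ Set.Icc (0 : ℝ) 1) (x : EuclideanSpace ℝ (Fin d)) : segmentPositions W s x ⊆ W := by
  rintro X ⟨h1, h2⟩
  have := hW h1 h2 (a := 1 - s) (b := s) (by linarith [hs.2]) hs.1 (by ring)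
  convert this using 1
  module

/-- Away from the boundary layer `D`, a point of `W` can be any point of a short segment. -/
theorem subset_segmentPositions_union {W D : Set (EuclideanSpace ℝ (Fin d))} {δ : ℝ} (hδ : 0 ≤ δ)
    (hD : ∀ X ∈ W, X ∉ D → Metric.closedBall X δ ⊆ W) {s : ℝ} (hs : s ∈ Set.Icc (0 : ℝ) 1)
    {x : EuclideanSpace ℝ (Fin d)} (hx : ‖x‖ ≤ 1) : W ⊆ segmentPositions W s (δ • x) ∪ D := by
  intro X hX
  by_cases hXD : X ∈ D
  · exact Or.inr hXD
  have hmem : ∀ c : ℝ, |c| ≤ 1 → X + c • δ • x ∈ W := by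
    intro c hc
    refine hD X hX hXD ?_
    rw [mem_closedBall_iff_norm, add_sub_cancel_left, norm_smul, norm_smul, Real.norm_eq_abs,
      Real.norm_of_nonneg hδ]
    calc |c| * (δ * ‖x‖) ≤ 1 * (δ * 1) := by gcongr
      _ = δ := by ring
  refine Or.inl ⟨?_, ?_⟩
  · have := hmem (-s) (by rw [abs_neg, abs_of_nonneg hs.1]; exact hs.2)
    convert this using 1
    module
  · have := hmem (1 - s) (by rw [abs_of_nonneg (by linarith [hs.2])]; linarith [hs.1])
    convert this using 1
    module

/-- The integral over the positions of two crossing edges with given shapes: when the positions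
are described by the crossing point and by the points of the two edges above it, they decouple. -/
theorem lintegral_edgePair (φ : L ≃ₗᵢ[ℝ] ℂ) {δ : ℝ} (hδ : 0 < δ)
    {x y : EuclideanSpace ℝ (Fin d)}
    (hxy : planeDet φ (L.orthogonalProjectionOnto x) (L.orthogonalProjectionOnto y) ≠ 0) {z : L}
    (hx : ‖x‖ ≤ 1) (hy : ‖y‖ ≤ 1) {s r : ℝ} (hs : s ∈ Set.Icc (0 : ℝ) 1)
    (hr : r ∈ Set.Icc (0 : ℝ) 1)
    (hz : s • L.orthogonalProjectionOnto x = z + r • L.orthogonalProjectionOnto y)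
    {W : Set (EuclideanSpace ℝ (Fin d))} (hW : MeasurableSet W)
    {A : Set L} (hA : MeasurableSet A) :
    ∫⁻ v, ∫⁻ u : Lᗮ, (crossingSet φ δ A ∩ Set.univ.pi fun _ => W).indicator (fun _ => (1 : ℝ≥0∞))
        (edgePair δ x y z v u) =
      ∫⁻ p in A, fibreVolume (segmentPositions W s (δ • x)) p *
        fibreVolume (segmentPositions W r (δ • y)) p := by
  let E := EuclideanSpace ℝ (Fin d)
  let F : (Fin 4 → E) → ℝ≥0∞ :=
    (crossingSet φ δ A ∩ Set.univ.pi fun _ => W).indicator fun _ => (1 : ℝ≥0∞)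
  have hF : Measurable F :=
    measurable_const.indicator ((measurableSet_crossingSet φ δ hA).inter (.univ_pi fun _ => hW))
  have hG : Measurable fun p : E × Lᗮ => F (edgePair δ x y z p.1 p.2) :=
    hF.comp ((measurable_edgePair δ).comp (f := fun p : E × Lᗮ => ((x, y), z, p.1, p.2))
      (by fun_prop))
  -- Both base points are moved so that `p + X` and `p + u` are the points of the two edges above
  -- the crossing point `p`.
  have hmem : ∀ (p : L) (X u : Lᗮ),
      edgePair δ x y z ((p : E) + X - s • δ • x) (u - r • δ • Lᗮ.orthogonalProjectionOnto y) ∈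
        (crossingSet φ δ A ∩ Set.univ.pi fun _ => W) ↔
      p ∈ A ∧ (p : E) + X ∈ segmentPositions W s (δ • x) ∧
        (p : E) + u ∈ segmentPositions W r (δ • y) := by
    intro p X u
    have h1 : edgePair δ x y z ((p : E) + X - s • δ • x)
        (u - r • δ • Lᗮ.orthogonalProjectionOnto y) ∈ crossingSet φ δ A ↔ p ∈ A := by
      rw [edgePair_mem_crossingSet_iff φ hδ hxy]
      constructor
      · rintro ⟨-, -, s', hs', r', hr', hz', hA'⟩
        have e1 := ((smul_eq_add_smul_iff φ hxy s r).1 hz).1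
        have e2 := ((smul_eq_add_smul_iff φ hxy s' r').1 hz').1
        rw [e2, ← e1, smul_smul, sub_add_cancel, projOnto_coe_add_orthogonal] at hA'
        exact hA'
      · intro hpA
        refine ⟨hx, hy, s, hs, r, hr, hz, ?_⟩
        rwa [smul_smul, sub_add_cancel, projOnto_coe_add_orthogonal]
    have h2 : ((L.orthogonalProjectionOnto ((p : E) + X - s • δ • x) + δ • z : L) : E) +
        ((u - r • δ • Lᗮ.orthogonalProjectionOnto y : Lᗮ) : E) = (p : E) + u - r • δ • y := by
      have e3 : (L.orthogonalProjectionOnto y : E) + (Lᗮ.orthogonalProjectionOnto y : E) = y :=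
        L.starProjection_add_starProjection_orthogonal y
      have e4 : (s • L.orthogonalProjectionOnto x : E) =
          (z : E) + r • (L.orthogonalProjectionOnto y : E) := by
        exact_mod_cast congrArg (Subtype.val : L → E) hz
      rw [map_sub, projOnto_coe_add_orthogonal, map_smul, map_smul]
      push_cast
      rw [smul_comm s δ, e4]
      nth_rewrite 3 [← e3]
      module
    rw [Set.mem_inter_iff, h1]
    refine and_congr_right fun _ => ?_
    simp only [edgePair, h2, Set.mem_pi, Set.mem_univ, true_imp_iff, Fin.forall_fin_succ,
      segmentPositions, Set.mem_ofPred_eq]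
    simp
    tauto
  have hm1 := measurableSet_segmentPositions hW s (δ • x)
  have hm2 := measurableSet_segmentPositions hW r (δ • y)
  have hout : Measurable fun v : E => ∫⁻ u : Lᗮ, F (edgePair δ x y z v u) :=
    hG.lintegral_prod_right'
  change ∫⁻ v : E, ∫⁻ u : Lᗮ, F (edgePair δ x y z v u) = _
  rw [← lintegral_sub_right_eq_self _ (s • δ • x), lintegral_eq_lintegral_add_orthogonal L
    (by exact hout.comp (measurable_id.sub_const _)), ← lintegral_indicator hA]
  refine lintegral_congr fun p => ?_
  have h3 : ∀ X : Lᗮ, ∫⁻ u : Lᗮ, F (edgePair δ x y z ((p : E) + X - s • δ • x) u) =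
      A.indicator (fun _ => {X : Lᗮ | (p : E) + X ∈ segmentPositions W s (δ • x)}.indicator
        (fun _ => fibreVolume (segmentPositions W r (δ • y)) p) X) p := by
    intro X
    rw [← lintegral_sub_right_eq_self _ (r • δ • Lᗮ.orthogonalProjectionOnto y)]
    have hset : ∀ u : Lᗮ, F (edgePair δ x y z ((p : E) + X - s • δ • x)
        (u - r • δ • Lᗮ.orthogonalProjectionOnto y)) =
        {u : Lᗮ | p ∈ A ∧ (p : E) + X ∈ segmentPositions W s (δ • x) ∧
          (p : E) + u ∈ segmentPositions W r (δ • y)}.indicator (fun _ => 1) u := by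
      intro u
      classical
      simp only [F, Set.indicator_apply, hmem p X u, Set.mem_ofPred_eq]
    simp_rw [hset]
    by_cases hp : p ∈ A
    · by_cases hX : (p : E) + X ∈ segmentPositions W s (δ • x)
      · rw [Set.indicator_of_mem hp, Set.indicator_of_mem (by exact hX)]
        simp only [hp, hX, true_and]
        rw [lintegral_indicator_const (measurableSet_fibre_section hm2 p), one_mul]
        rfl
      · rw [Set.indicator_of_mem hp, Set.indicator_of_notMem (by exact hX)]
        simp [hX]
    · rw [Set.indicator_of_notMem hp]
      simp [hp]
  simp_rw [h3]
  by_cases hp : p ∈ A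
  · simp only [Set.indicator_of_mem hp]
    rw [lintegral_indicator_const (measurableSet_fibre_section hm1 p), mul_comm]
    rfl
  · simp only [Set.indicator_of_notMem hp, lintegral_zero]

end Fibres

/-! ### The boundary layer of a convex body -/

/-- The points of a convex body `W` within distance `δ` of its complement have volume `O(δ)`: if
`W` contains the ball of radius `ρ` about `x₀`, then they are outside the image of `W` under the
homothety with centre `x₀` and ratio `1 - δ / ρ`. -/
theorem exists_boundary_layer {d : ℕ} (hd : 1 ≤ d) {W : Set (EuclideanSpace ℝ (Fin d))}
    (hWconv : Convex ℝ W) (hWcomp : IsCompact W) (hWvol : volume W = 1) :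
    ∃ C : ℝ, 0 ≤ C ∧ ∀ δ : ℝ, 0 < δ → ∃ D : Set (EuclideanSpace ℝ (Fin d)), MeasurableSet D ∧
      volume D ≤ ENNReal.ofReal (C * δ) ∧ ∀ X ∈ W, X ∉ D → Metric.closedBall X δ ⊆ W := by
  have hint : (interior W).Nonempty := by
    by_contra h
    have h1 : frontier W = W := by
      rw [frontier, hWcomp.isClosed.closure_eq, Set.not_nonempty_iff_eq_empty.1 h, Set.sdiff_empty]
    have h2 := hWconv.addHaar_frontier volume
    rw [h1, hWvol] at h2
    exact one_ne_zero h2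
  obtain ⟨x₀, hx₀⟩ := hint
  obtain ⟨ρ, hρ, hball⟩ := Metric.nhds_basis_closedBall.mem_iff.1 (mem_interior_iff_mem_nhds.1 hx₀)
  have hx₀W : x₀ ∈ W := interior_subset hx₀
  refine ⟨d / ρ, by positivity, fun δ hδ => ?_⟩
  by_cases hδρ : ρ ≤ δ
  -- For `δ ≥ ρ` the bound `d δ / ρ ≥ 1` allows the layer to be all of `W`.
  · refine ⟨W, hWcomp.isClosed.measurableSet, ?_, fun X h1 h2 => absurd h1 h2⟩
    rw [hWvol, ENNReal.one_le_ofReal, div_mul_eq_mul_div, one_le_div hρ]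
    have : (1 : ℝ) ≤ d := by exact_mod_cast hd
    nlinarith
  rw [not_le] at hδρ
  obtain ⟨ε, hε⟩ : ∃ ε, ε = δ / ρ := ⟨_, rfl⟩
  have hε0 : 0 < ε := hε ▸ div_pos hδ hρ
  have hε1 : ε < 1 := by rw [hε]; exact (div_lt_one hρ).2 hδρ
  have hεδ : ε * ρ = δ := by rw [hε]; field_simp
  have hsub : AffineMap.homothety x₀ (1 - ε) '' W ⊆ W := by
    rintro _ ⟨w, hw, rfl⟩
    have := hWconv hx₀W hw hε0.le (b := 1 - ε) (by linarith) (by ring)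
    convert this using 1
    rw [AffineMap.homothety_apply, vsub_eq_sub, vadd_eq_add]
    module
  have hcomp : IsCompact (AffineMap.homothety x₀ (1 - ε) '' W) :=
    hWcomp.image (AffineMap.homothety_continuous x₀ (1 - ε))
  refine ⟨W \ AffineMap.homothety x₀ (1 - ε) '' W,
    hWcomp.isClosed.measurableSet.diff hcomp.isClosed.measurableSet, ?_, ?_⟩
  · rw [measure_sdiff hsub hcomp.isClosed.measurableSet.nullMeasurableSet hcomp.measure_ne_top,
      Measure.addHaar_image_homothety, hWvol, mul_one, finrank_euclideanSpace_fin,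
      abs_of_nonneg (by have : 0 ≤ 1 - ε := by linarith
                        positivity), ← ENNReal.ofReal_one,
      ← ENNReal.ofReal_sub _ (by have : 0 ≤ 1 - ε := by linarith
                                 positivity)]
    refine ENNReal.ofReal_le_ofReal ?_
    have hbern := one_add_mul_le_pow (a := -ε) (by linarith) d
    rw [div_mul_eq_mul_div, mul_div_assoc, ← hε]
    rw [← sub_eq_add_neg] at hbern
    linarith
  · intro X hX hXD Y hY
    have hX' : X ∈ AffineMap.homothety x₀ (1 - ε) '' W := by
      by_contra h
      exact hXD ⟨hX, h⟩
    obtain ⟨w, hw, rfl⟩ := hX'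
    -- `Y = (1 - ε) w + ε y` with `y = x₀ + (Y - X) / ε` in the ball of radius `ρ`.
    set X := AffineMap.homothety x₀ (1 - ε) w with hXdef
    have h1 : x₀ + ε⁻¹ • (Y - X) ∈ W := by
      refine hball ?_
      rw [mem_closedBall_iff_norm, add_sub_cancel_left, norm_smul,
        Real.norm_of_nonneg (by positivity), inv_mul_le_iff₀ hε0, hεδ]
      exact mem_closedBall_iff_norm.1 hY
    have := hWconv h1 hw hε0.le (b := 1 - ε) (by linarith) (by ring)
    convert this using 1
    rw [smul_add, smul_smul, mul_inv_cancel₀ hε0.ne', hXdef, AffineMap.homothety_apply,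
      vsub_eq_sub, vadd_eq_add]
    module

/-! ### Quadruples in special position -/

section Null

variable {d : ℕ} {L : Submodule ℝ (EuclideanSpace ℝ (Fin d))}

/-- Almost all pairs of vectors have linearly independent projections: for almost every `x` the
projection of `x` is nonzero, and then the exceptional `y` form a proper subspace. -/
theorem ae_planeDet_ne_zero (φ : L ≃ₗᵢ[ℝ] ℂ) :
    ∀ᵐ p : EuclideanSpace ℝ (Fin d) × EuclideanSpace ℝ (Fin d),
      planeDet φ (L.orthogonalProjectionOnto p.1) (L.orthogonalProjectionOnto p.2) ≠ 0 := by
  let E := EuclideanSpace ℝ (Fin d)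
  have hlift : ∀ a : L, L.orthogonalProjectionOnto (a : E) = a := fun a => by simp
  have hker : ∀ᵐ x : E, L.orthogonalProjectionOnto x ≠ 0 := by
    rw [ae_iff]
    simp only [ne_eq, not_not]
    refine Measure.addHaar_submodule volume (L.orthogonalProjectionOnto : E →ₗ[ℝ] L).ker
      fun htop => ?_
    have h1 : ((φ.symm 1 : L) : E) ∈ (L.orthogonalProjectionOnto : E →ₗ[ℝ] L).ker :=
      htop ▸ Submodule.mem_top
    rw [LinearMap.mem_ker, ContinuousLinearMap.coe_coe, hlift] at h1
    simp at h1
  have hcont : Continuous fun p : E × E =>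
      planeDet φ (L.orthogonalProjectionOnto p.1) (L.orthogonalProjectionOnto p.2) :=
    (continuous_planeDet φ).comp (by fun_prop : Continuous fun p : E × E =>
      (L.orthogonalProjectionOnto p.1, L.orthogonalProjectionOnto p.2))
  have hm : MeasurableSet {p : E × E |
      planeDet φ (L.orthogonalProjectionOnto p.1) (L.orthogonalProjectionOnto p.2) = 0} :=
    hcont.measurable (measurableSet_singleton 0)
  rw [ae_iff]
  simp only [ne_eq, not_not]
  rw [Measure.volume_eq_prod, Measure.measure_prod_null hm]
  filter_upwards [hker] with x hx
  let ℓ : E →ₗ[ℝ] ℝ :=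
    { toFun := fun y => planeDet φ (L.orthogonalProjectionOnto x) (L.orthogonalProjectionOnto y)
      map_add' := fun y y' => by simp only [planeDet, map_add, Complex.add_im, Complex.add_re]; ring
      map_smul' := fun c y => by
        simp only [planeDet, map_smul, Complex.smul_im, Complex.smul_re, smul_eq_mul,
          RingHom.id_apply]
        ring }
  refine Measure.addHaar_submodule volume ℓ.ker fun htop => hx ?_
  have h1 : ((φ.symm (Complex.I * φ (L.orthogonalProjectionOnto x)) : L) : E) ∈ ℓ.ker :=
    htop ▸ Submodule.mem_top
  have h2 : planeDet φ (L.orthogonalProjectionOnto x)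
      (φ.symm (Complex.I * φ (L.orthogonalProjectionOnto x))) = 0 := by
    have h3 := LinearMap.mem_ker.1 h1
    change planeDet φ _ (L.orthogonalProjectionOnto _) = 0 at h3
    rwa [hlift] at h3
  rw [← φ.map_eq_zero_iff, ← Complex.normSq_eq_zero, Complex.normSq_apply]
  rw [planeDet, φ.apply_symm_apply] at h2
  simp only [Complex.mul_im, Complex.mul_re, Complex.I_re, Complex.I_im] at h2
  linarith

/-- Almost no quadruple has parallel projected segments. -/
theorem ae_crossingDet_ne_zero (hL : Module.finrank ℝ L = 2) (φ : L ≃ₗᵢ[ℝ] ℂ) :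
    ∀ᵐ q : Fin 4 → EuclideanSpace ℝ (Fin d), crossingDet φ q ≠ 0 := by
  have hm : MeasurableSet {q : Fin 4 → EuclideanSpace ℝ (Fin d) | crossingDet φ q = 0} :=
    measurable_crossingDet φ (measurableSet_singleton 0)
  rw [ae_iff]
  simp only [ne_eq, not_not]
  rw [← lintegral_indicator_one hm, lintegral_quadruples hL (measurable_one.indicator hm) one_pos]
  refine mul_eq_zero_of_right _ (lintegral_eq_zero_of_ae_eq_zero ?_)
  filter_upwards [ae_planeDet_ne_zero φ] with p hp
  have h1 : ∀ (z : L) v u, edgePair 1 p.1 p.2 z v u ∉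
      {q : Fin 4 → EuclideanSpace ℝ (Fin d) | crossingDet φ q = 0} := by
    intro z v u h
    simp only [Set.mem_ofPred_eq, crossingDet, edgePair, Matrix.cons_val, add_sub_cancel_left,
      one_smul] at h
    exact hp h
  simp only [Set.indicator_of_notMem (h1 _ _ _), lintegral_zero, Pi.zero_apply]

theorem ae_injective {E : Type*} [NormedAddCommGroup E] [NormedSpace ℝ E] [FiniteDimensional ℝ E]
    [Nontrivial E] [MeasureSpace E] [BorelSpace E] [(volume : Measure E).IsAddHaarMeasure] (n : ℕ) :
    ∀ᵐ q : Fin n → E, Function.Injective q := by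
  have h : ∀ i j : Fin n, ∀ᵐ q : Fin n → E, q i = q j → i = j := by
    intro i j
    by_cases hij : i = j
    · simp [hij]
    simp only [hij, imp_false]
    let ℓ : (Fin n → E) →ₗ[ℝ] E :=
      LinearMap.proj (R := ℝ) (φ := fun _ : Fin n => E) i - LinearMap.proj j
    have h0 : volume (ℓ.ker : Set (Fin n → E)) = 0 := by
      refine Measure.addHaar_submodule volume ℓ.ker fun htop => ?_
      obtain ⟨v, hv⟩ := exists_ne (0 : E)
      have h1 : (Pi.single i v : Fin n → E) ∈ ℓ.ker := htop ▸ Submodule.mem_top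
      rw [LinearMap.mem_ker] at h1
      simp only [ℓ, LinearMap.sub_apply, LinearMap.proj_apply, Pi.single_eq_same,
        Pi.single_eq_of_ne (Ne.symm hij), sub_zero] at h1
      exact hv h1
    rw [ae_iff]
    convert h0 using 2
    ext q
    simp [ℓ, sub_eq_zero]
  filter_upwards [ae_all_iff.2 fun i => ae_all_iff.2 (h i)] with q hq
  exact fun i j hij => hq i j hij

end Null

/-! ### The volume of the crossing quadruples in `W` -/

section Bounds

variable {d : ℕ} {L : Submodule ℝ (EuclideanSpace ℝ (Fin d))}

theorem exists_fibreVolume_le {W : Set (EuclideanSpace ℝ (Fin d))} (hW : IsCompact W) :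
    ∃ M : ℝ≥0, ∀ p : L, fibreVolume W p ≤ M := by
  obtain ⟨R, hR⟩ := hW.isBounded.subset_closedBall 0
  refine ⟨(volume (Metric.closedBall (0 : Lᗮ) R)).toNNReal, fun p => ?_⟩
  rw [ENNReal.coe_toNNReal (isCompact_closedBall _ _).measure_ne_top]
  refine measure_mono fun u hu => ?_
  have h1 := mem_closedBall_zero_iff.1 (hR hu)
  have h2 := norm_sq_coe_add_orthogonal L p u
  rw [mem_closedBall_zero_iff]
  refine le_trans (abs_le_of_sq_le_sq' ?_ (norm_nonneg _)).2 h1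
  nlinarith [sq_nonneg ‖p‖]

/-- The upper bound for the contribution of a crossing shape. -/
theorem setLIntegral_segmentPositions_le {W : Set (EuclideanSpace ℝ (Fin d))} (hWc : Convex ℝ W)
    {s r : ℝ} (hs : s ∈ Set.Icc (0 : ℝ) 1) (hr : r ∈ Set.Icc (0 : ℝ) 1)
    (x y : EuclideanSpace ℝ (Fin d)) (A : Set L) :
    ∫⁻ p in A, fibreVolume (segmentPositions W s x) p * fibreVolume (segmentPositions W r y) p ≤
      ∫⁻ p in A, fibreVolume W p ^ 2 := by
  refine lintegral_mono fun p => ?_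
  rw [pow_two]
  exact mul_le_mul' (fibreVolume_mono (segmentPositions_subset hWc hs x) p)
    (fibreVolume_mono (segmentPositions_subset hWc hr y) p)

/-- The lower bound for the contribution of a crossing shape, up to the boundary layer `D`. -/
theorem le_setLIntegral_segmentPositions_add {W D : Set (EuclideanSpace ℝ (Fin d))}
    (hWc : Convex ℝ W) (hDm : MeasurableSet D) {δ : ℝ} (hδ : 0 ≤ δ)
    (hD : ∀ X ∈ W, X ∉ D → Metric.closedBall X δ ⊆ W) {M : ℝ≥0}
    (hM : ∀ p : L, fibreVolume W p ≤ M) {s r : ℝ} (hs : s ∈ Set.Icc (0 : ℝ) 1)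
    (hr : r ∈ Set.Icc (0 : ℝ) 1) {x y : EuclideanSpace ℝ (Fin d)} (hx : ‖x‖ ≤ 1) (hy : ‖y‖ ≤ 1)
    (A : Set L) :
    ∫⁻ p in A, fibreVolume W p ^ 2 ≤
      (∫⁻ p in A, fibreVolume (segmentPositions W s (δ • x)) p *
        fibreVolume (segmentPositions W r (δ • y)) p) + 2 * M * volume D := by
  have hpt : ∀ p : L, fibreVolume W p ^ 2 ≤ fibreVolume (segmentPositions W s (δ • x)) p *
      fibreVolume (segmentPositions W r (δ • y)) p + 2 * M * fibreVolume D p := by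
    intro p
    have h1 : fibreVolume W p ≤ fibreVolume (segmentPositions W s (δ • x)) p + fibreVolume D p :=
      (fibreVolume_mono (subset_segmentPositions_union hδ hD hs hx) p).trans
        (fibreVolume_union_le _ _ p)
    have h2 : fibreVolume W p ≤ fibreVolume (segmentPositions W r (δ • y)) p + fibreVolume D p :=
      (fibreVolume_mono (subset_segmentPositions_union hδ hD hr hy) p).trans
        (fibreVolume_union_le _ _ p)
    have h3 : fibreVolume (segmentPositions W s (δ • x)) p ≤ M :=
      (fibreVolume_mono (segmentPositions_subset hWc hs _) p).trans (hM p)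
    calc fibreVolume W p ^ 2
        ≤ (fibreVolume (segmentPositions W s (δ • x)) p + fibreVolume D p) * fibreVolume W p := by
          rw [pow_two]; gcongr
      _ = fibreVolume (segmentPositions W s (δ • x)) p * fibreVolume W p +
          fibreVolume D p * fibreVolume W p := add_mul _ _ _
      _ ≤ fibreVolume (segmentPositions W s (δ • x)) p *
            (fibreVolume (segmentPositions W r (δ • y)) p + fibreVolume D p) +
          fibreVolume D p * M := by gcongr; exact hM p
      _ ≤ fibreVolume (segmentPositions W s (δ • x)) p *
            fibreVolume (segmentPositions W r (δ • y)) p + M * fibreVolume D p +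
          fibreVolume D p * M := by rw [mul_add]; gcongr
      _ = _ := by ring
  calc ∫⁻ p in A, fibreVolume W p ^ 2
      ≤ ∫⁻ p in A, (fibreVolume (segmentPositions W s (δ • x)) p *
          fibreVolume (segmentPositions W r (δ • y)) p + 2 * M * fibreVolume D p) :=
        lintegral_mono hpt
    _ = (∫⁻ p in A, fibreVolume (segmentPositions W s (δ • x)) p *
          fibreVolume (segmentPositions W r (δ • y)) p) +
          2 * M * ∫⁻ p in A, fibreVolume D p := by
        rw [lintegral_add_right _ ((measurable_fibreVolume hDm).const_mul _),
          lintegral_const_mul _ (measurable_fibreVolume hDm)]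
    _ ≤ _ := by
        gcongr
        rw [← lintegral_fibreVolume (L := L) hDm]
        exact setLIntegral_le_lintegral _ _

/-- Integration over the crossing configurations, shapes first. -/
theorem lintegral_lintegral_crossingShapes (c : ℝ≥0∞) :
    ∫⁻ p : EuclideanSpace ℝ (Fin d) × EuclideanSpace ℝ (Fin d), ∫⁻ z : L,
      (crossingShapes L).indicator (fun _ => c) (p.1, p.2, z) = c * volume (crossingShapes L) := by
  have hm := (isCompact_crossingShapes L).measurableSet
  have hf : Measurable fun q : (EuclideanSpace ℝ (Fin d) × EuclideanSpace ℝ (Fin d)) × L =>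
      (crossingShapes L).indicator (fun _ => c) (q.1.1, q.1.2, q.2) :=
    (measurable_const.indicator hm).comp MeasurableEquiv.prodAssoc.measurable
  have hg : Measurable fun q : EuclideanSpace ℝ (Fin d) × EuclideanSpace ℝ (Fin d) × L =>
      (crossingShapes L).indicator (fun _ => c) q := measurable_const.indicator hm
  have hgx : ∀ x, Measurable fun q : EuclideanSpace ℝ (Fin d) × L =>
      (crossingShapes L).indicator (fun _ => c) (x, q) := fun x => hg.comp measurable_prodMk_left
  rw [← lintegral_indicator_const hm, Measure.volume_eq_prod,
    lintegral_prod _ hf.lintegral_prod_right'.aemeasurable, Measure.volume_eq_prod,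
    lintegral_prod _ hg.aemeasurable]
  refine lintegral_congr fun x => ?_
  rw [Measure.volume_eq_prod, lintegral_prod _ (hgx x).aemeasurable]

/-- The volume of the crossing quadruples in `W` differs from its leading term, which is the
integral of the squared fibre volumes, by at most a multiple of the volume of the boundary
layer `D`. -/
theorem volume_crossingSet_bounds (hL : Module.finrank ℝ L = 2) (φ : L ≃ₗᵢ[ℝ] ℂ)
    {W D : Set (EuclideanSpace ℝ (Fin d))} (hWc : Convex ℝ W) (hWm : MeasurableSet W)
    (hDm : MeasurableSet D) {δ : ℝ} (hδ : 0 < δ)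
    (hD : ∀ X ∈ W, X ∉ D → Metric.closedBall X δ ⊆ W) {M : ℝ≥0}
    (hM : ∀ p : L, fibreVolume W p ≤ M) {A : Set L} (hA : MeasurableSet A) :
    volume (crossingSet φ δ A ∩ Set.univ.pi fun _ => W) ≤
        ENNReal.ofReal (δ ^ (2 * d + 2)) *
          ((∫⁻ p in A, fibreVolume W p ^ 2) * volume (crossingShapes L)) ∧
      ENNReal.ofReal (δ ^ (2 * d + 2)) *
          ((∫⁻ p in A, fibreVolume W p ^ 2) * volume (crossingShapes L)) ≤
        volume (crossingSet φ δ A ∩ Set.univ.pi fun _ => W) +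
          ENNReal.ofReal (δ ^ (2 * d + 2)) *
            (2 * M * volume D * volume (crossingShapes L)) := by
  have hCm : MeasurableSet (crossingSet φ δ A ∩ Set.univ.pi fun _ => W) :=
    (measurableSet_crossingSet φ δ hA).inter (.univ_pi fun _ => hWm)
  have hzero : ∀ {x y : EuclideanSpace ℝ (Fin d)} {z : L}, (x, y, z) ∉ crossingShapes L →
      planeDet φ (L.orthogonalProjectionOnto x) (L.orthogonalProjectionOnto y) ≠ 0 →
      ∫⁻ v, ∫⁻ u : Lᗮ, (crossingSet φ δ A ∩ Set.univ.pi fun _ => W).indicator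
        (fun _ => (1 : ℝ≥0∞)) (edgePair δ x y z v u) = 0 := by
    intro x y z hxyz hdet
    have h1 : ∀ v (u : Lᗮ), edgePair δ x y z v u ∉
        crossingSet φ δ A ∩ Set.univ.pi fun _ => W := by
      rintro v u ⟨h, -⟩
      obtain ⟨hx, hy, s, hs, r, hr, hz, -⟩ := (edgePair_mem_crossingSet_iff φ hδ hdet).1 h
      exact hxyz ⟨hx, hy, s, hs, r, hr, hz⟩
    simp only [Set.indicator_of_notMem (h1 _ _), lintegral_zero]
  have hvol := lintegral_indicator_const hCm (μ := volume) (1 : ℝ≥0∞)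
  rw [one_mul, lintegral_quadruples hL (measurable_const.indicator hCm) hδ] at hvol
  rw [← hvol, ← lintegral_lintegral_crossingShapes, ← lintegral_lintegral_crossingShapes, ← mul_add]
  have hshape : ∀ c : ℝ≥0∞, Measurable fun q : (EuclideanSpace ℝ (Fin d) ×
      EuclideanSpace ℝ (Fin d)) × L =>
      (crossingShapes L).indicator (fun _ => c) (q.1.1, q.1.2, q.2) := fun c =>
    (measurable_const.indicator (isCompact_crossingShapes L).measurableSet).comp
      MeasurableEquiv.prodAssoc.measurable
  constructor
  · gcongr ENNReal.ofReal _ * ?_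
    refine lintegral_mono_ae ?_
    filter_upwards [ae_planeDet_ne_zero φ] with p hp
    refine lintegral_mono fun z => ?_
    by_cases hz : (p.1, p.2, z) ∈ crossingShapes L
    · rw [Set.indicator_of_mem hz]
      obtain ⟨hx, hy, s, hs, r, hr, h⟩ := hz
      rw [lintegral_edgePair φ hδ hp hx hy hs hr h hWm hA]
      exact setLIntegral_segmentPositions_le hWc hs hr _ _ A
    · rw [hzero hz hp]
      exact zero_le
  · gcongr ENNReal.ofReal _ * ?_
    rw [← lintegral_add_right _ (hshape _).lintegral_prod_right']
    refine lintegral_mono_ae ?_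
    filter_upwards [ae_planeDet_ne_zero φ] with p hp
    have hshape' : Measurable fun z : L =>
        (crossingShapes L).indicator (fun _ => 2 * M * volume D) (p.1, p.2, z) :=
      Measurable.comp (g := (crossingShapes L).indicator fun _ => 2 * M * volume D)
        (f := fun z : L => (p.1, p.2, z))
        (measurable_const.indicator (isCompact_crossingShapes L).measurableSet) (by fun_prop)
    rw [← lintegral_add_right _ hshape']
    refine lintegral_mono fun z => ?_
    by_cases hz : (p.1, p.2, z) ∈ crossingShapes L
    · rw [Set.indicator_of_mem hz, Set.indicator_of_mem hz]
      obtain ⟨hx, hy, s, hs, r, hr, h⟩ := hz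
      rw [lintegral_edgePair φ hδ hp hx hy hs hr h hWm hA]
      exact le_setLIntegral_segmentPositions_add hWc hDm hδ.le hD hM hs hr hx hy A
    · rw [Set.indicator_of_notMem hz]
      exact zero_le

/-! ### The intensity measure -/

theorem pi_smul_restrict {X : Type*} [MeasureSpace X] [SigmaFinite (volume : Measure X)] {n : ℕ}
    (c : ℝ≥0) (W : Set X) {C : Set (Fin n → X)} (hC : MeasurableSet C) :
    Measure.pi (fun _ => (c : ℝ≥0∞) • volume.restrict W) C =
      (c : ℝ≥0∞) ^ n * volume (C ∩ Set.univ.pi fun _ => W) := by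
  have h : Measure.pi (fun _ : Fin n => (c : ℝ≥0∞) • (volume : Measure X).restrict W) =
      (c : ℝ≥0∞) ^ n • (volume : Measure (Fin n → X)).restrict (Set.univ.pi fun _ => W) := by
    have : SigmaFinite ((c : ℝ≥0∞) • (volume : Measure X).restrict W) :=
      inferInstanceAs (SigmaFinite (c • (volume : Measure X).restrict W))
    refine Measure.pi_eq fun s hs => ?_
    rw [volume_pi, Measure.restrict_pi_pi, Measure.smul_apply, Measure.pi_pi]
    simp [Finset.prod_mul_distrib]
  rw [h, Measure.smul_apply, Measure.restrict_apply hC, smul_eq_mul]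

/-- The intensity measure of the crossing process of a Poisson process, as a volume of
quadruples. -/
theorem intensity_crossingProcess {Ω : Type*} [MeasurableSpace Ω] {P : Measure Ω}
    [IsProbabilityMeasure P] {V : Ω → Set (EuclideanSpace ℝ (Fin d))} {t : ℝ}
    {W : Set (EuclideanSpace ℝ (Fin d))} (hW : volume W ≠ ∞) (hd : 1 ≤ d)
    (h : IsPoissonProcess P V (ENNReal.ofReal t • volume.restrict W))
    (hL : Module.finrank ℝ L = 2) (φ : L ≃ₗᵢ[ℝ] ℂ) (δ : ℝ) {A : Set L} (hA : MeasurableSet A) :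
    AEMeasurable (fun ω => crossingProcess L δ (V ω) A) P ∧
      intensity P (fun ω => crossingProcess L δ (V ω)) A =
        8⁻¹ * (ENNReal.ofReal t ^ 4 *
          volume (crossingSet φ δ A ∩ Set.univ.pi fun _ => W)) := by
  have : Nonempty (Fin d) := ⟨⟨0, hd⟩⟩
  let E := EuclideanSpace ℝ (Fin d)
  have : IsFiniteMeasure (ENNReal.ofReal t • (volume : Measure E).restrict W) :=
    ⟨by
      rw [Measure.smul_apply, Measure.restrict_apply_univ, smul_eq_mul]
      exact ENNReal.mul_lt_top ENNReal.ofReal_lt_top hW.lt_top⟩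
  have hnull : ∀ {S : Set (Fin 4 → EuclideanSpace ℝ (Fin d))}, MeasurableSet S → volume S = 0 →
      Measure.pi (fun _ : Fin 4 => ENNReal.ofReal t • (volume : Measure E).restrict W) S = 0 := by
    intro S hS h0
    rw [ENNReal.ofReal, pi_smul_restrict _ _ hS, measure_inter_null_of_null_left _ h0, mul_zero]
  have hinj : ∀ᵐ q ∂Measure.pi fun _ : Fin 4 =>
      ENNReal.ofReal t • (volume : Measure E).restrict W, Function.Injective q :=
    ae_iff.2 (hnull (measurableSet_injective 4).compl (ae_iff.1 (ae_injective 4)))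
  have hdm : MeasurableSet {q : Fin 4 → EuclideanSpace ℝ (Fin d) | crossingDet φ q = 0} :=
    measurable_crossingDet φ (measurableSet_singleton 0)
  have hd0 : volume {q : Fin 4 → EuclideanSpace ℝ (Fin d) | crossingDet φ q = 0} = 0 := by
    have := ae_iff.1 (ae_crossingDet_ne_zero hL φ)
    simpa only [ne_eq, not_not] using this
  -- Almost surely there are no parallel projected segments.
  have hgen : ∀ᵐ ω ∂P, ∀ q : Fin 4 → EuclideanSpace ℝ (Fin d), (∀ i, q i ∈ V ω) →
      Function.Injective q → crossingDet φ q ≠ 0 := by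
    obtain ⟨h1, h2⟩ := h.factorial_moment hinj hdm
    rw [hnull hdm hd0, lintegral_eq_zero_iff' h1] at h2
    filter_upwards [h2] with ω hω q hqV hqi hq
    rw [Pi.zero_apply, tupleMeasure, Measure.restrict_apply
      (hdm.inter (measurableSet_injective 4)), Measure.count_eq_zero_iff] at hω
    have : q ∈ (∅ : Set (Fin 4 → EuclideanSpace ℝ (Fin d))) :=
      hω ▸ ⟨⟨hq, hqi⟩, fun i _ => hqV i⟩
    exact this
  have hCm := measurableSet_crossingSet φ δ hA
  obtain ⟨h1, h2⟩ := h.factorial_moment hinj hCm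
  have hae : (fun ω => crossingProcess L δ (V ω) A) =ᵐ[P] fun ω =>
      8⁻¹ * tupleMeasure 4 (V ω) (crossingSet φ δ A ∩ {q | Function.Injective q}) := by
    filter_upwards [hgen] with ω hω
    exact crossingProcess_apply φ δ (h.countable ω) hω hA
  refine ⟨(h1.const_mul _).congr hae.symm, ?_⟩
  rw [intensity, lintegral_congr_ae hae, lintegral_const_mul'' _ h1, h2, ENNReal.ofReal,
    pi_smul_restrict _ _ hCm]

end Bounds

theorem unitBallVolume_pos (n : ℕ) : 0 < unitBallVolume n :=
  ENNReal.toReal_pos (Metric.measure_closedBall_pos volume _ one_pos).ne'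
    (isCompact_closedBall _ _).measure_ne_top

theorem nonempty_linearIsometryEquiv_complex {F : Type*} [NormedAddCommGroup F]
    [InnerProductSpace ℝ F] (h : Module.finrank ℝ F = 2) : Nonempty (F ≃ₗᵢ[ℝ] ℂ) := by
  have : FiniteDimensional ℝ F := Module.finite_of_finrank_pos (by omega)
  exact ⟨(((stdOrthonormalBasis ℝ F).reindex (finCongr h)).repr).trans
    Complex.orthonormalBasisOneI.repr.symm⟩

theorem setLIntegral_fibreVolume_sq_le {d : ℕ} {L : Submodule ℝ (EuclideanSpace ℝ (Fin d))}
    {W : Set (EuclideanSpace ℝ (Fin d))} (hW : MeasurableSet W) {M : ℝ≥0}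
    (hM : ∀ p : L, fibreVolume W p ≤ M) (A : Set L) :
    ∫⁻ p in A, fibreVolume W p ^ 2 ≤ M * volume W := by
  rw [← lintegral_fibreVolume (L := L) hW, ← lintegral_const_mul _ (measurable_fibreVolume hW)]
  refine (setLIntegral_le_lintegral _ _).trans (lintegral_mono fun p => ?_)
  rw [pow_two]
  gcongr
  exact hM p

theorem integral_sliceVolume_sq {d : ℕ} {L : Submodule ℝ (EuclideanSpace ℝ (Fin d))}
    {W : Set (EuclideanSpace ℝ (Fin d))} (hW : MeasurableSet W) {M : ℝ≥0}
    (hM : ∀ p : L, fibreVolume W p ≤ M) (A : Set L) :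
    ∫ v in A, sliceVolume L W v ^ 2 = (∫⁻ p in A, fibreVolume W p ^ 2).toReal := by
  rw [← integral_toReal ((measurable_fibreVolume hW).pow_const 2).aemeasurable
    (ae_of_all _ fun p => ENNReal.pow_lt_top ((hM p).trans_lt ENNReal.coe_lt_top))]
  simp only [ENNReal.toReal_pow]
  rfl

theorem mainTheorem4 (d : ℕ) (hd : 3 ≤ d)
    (W : Set (EuclideanSpace ℝ (Fin d))) (hWconv : Convex ℝ W) (hWcomp : IsCompact W)
    (hWvol : volume W = 1)
    (L : Submodule ℝ (EuclideanSpace ℝ (Fin d))) (hL : Module.finrank ℝ L = 2)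
    (δ : ℝ → ℝ) (hδpos : ∀ t, 0 < t → 0 < δ t) (hδlim : Tendsto δ atTop (𝓝 0)) :
    crossingConst L =
        2 * Real.pi * unitBallVolume (d - 2) ^ 2 * ProbabilityTheory.beta (3 / 2) (d / 2) ^ 2 ∧
    ∃ (g : ℝ → Set L → ℝ) (c : ℝ → ℝ),
      c =O[atTop] δ ∧
      (∀ t, 0 < t → ∀ A : Set L, MeasurableSet A → |g t A| ≤ c t) ∧
      ∀ t, 0 < t →
        ∀ {Ω : Type*} [MeasurableSpace Ω] (P : Measure Ω) [IsProbabilityMeasure P]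
          (V : Ω → Set (EuclideanSpace ℝ (Fin d))),
          IsPoissonProcess P V (ENNReal.ofReal t • volume.restrict W) →
          ∀ A : Set L, MeasurableSet A →
            AEMeasurable (fun ω => crossingProcess L (δ t) (V ω) A) P ∧
            intensity P (fun ω => crossingProcess L (δ t) (V ω)) A ≠ ∞ ∧
            (intensity P (fun ω => crossingProcess L (δ t) (V ω)) A).toReal =
              1 / 8 * crossingConst L * t ^ 4 * δ t ^ (2 * d + 2) *
                ((∫ v in A, sliceVolume L W v ^ 2) + g t A) := by
  have hc : crossingConst L =
      2 * Real.pi * unitBallVolume (d - 2) ^ 2 * ProbabilityTheory.beta (3 / 2) (d / 2) ^ 2 := by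
    obtain ⟨φ⟩ := nonempty_linearIsometryEquiv_complex hL
    rw [crossingConst_eq, volume_crossingShapes hL (by omega) φ, ENNReal.toReal_ofReal]
    have := Real.pi_pos
    positivity
  have hc0 : 0 < crossingConst L := by
    have h1 := unitBallVolume_pos (d - 2)
    have h2 : 0 < ProbabilityTheory.beta (3 / 2) ((d : ℝ) / 2) :=
      beta_pos (by norm_num) (by have : (0 : ℝ) < d := by exact_mod_cast (by omega : 0 < d)
                                 positivity)
    have := Real.pi_pos
    rw [hc]
    positivity
  refine ⟨hc, ?_⟩
  obtain ⟨φ⟩ := nonempty_linearIsometryEquiv_complex hL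
  have hWm : MeasurableSet W := hWcomp.isClosed.measurableSet
  obtain ⟨C, hC0, hC⟩ := exists_boundary_layer (by omega) hWconv hWcomp hWvol
  obtain ⟨M, hM⟩ := exists_fibreVolume_le (L := L) hWcomp
  -- The error term is determined by the volume of the crossing quadruples in `W`.
  let J : ℝ → Set L → ℝ≥0∞ := fun t A => volume (crossingSet φ (δ t) A ∩ Set.univ.pi fun _ => W)
  refine ⟨fun t A => (J t A).toReal / (crossingConst L * δ t ^ (2 * d + 2)) -
    ∫ v in A, sliceVolume L W v ^ 2, fun t => 2 * M * C * δ t,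
    isBigO_const_mul_self _ _ _, fun t ht A hA => ?_, ?_⟩
  · have hδ := hδpos t ht
    have hδn : 0 < δ t ^ (2 * d + 2) := by positivity
    obtain ⟨D, hDm, hDvol, hD⟩ := hC (δ t) hδ
    obtain ⟨hup, hlow⟩ := volume_crossingSet_bounds hL φ hWconv hWm hDm hδ hD hM hA
    have hIfin : ∫⁻ p in A, fibreVolume W p ^ 2 ≠ ∞ :=
      ne_top_of_le_ne_top (by rw [hWvol]; finiteness)
        (setLIntegral_fibreVolume_sq_le hWm hM A)
    have hI := integral_sliceVolume_sq (L := L) hWm hM A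
    have hshapes : volume (crossingShapes L) = ENNReal.ofReal (crossingConst L) := by
      rw [crossingConst_eq, ENNReal.ofReal_toReal (isCompact_crossingShapes L).measure_ne_top]
    have hI0 : 0 ≤ ∫ v in A, sliceVolume L W v ^ 2 := hI ▸ ENNReal.toReal_nonneg
    have hIr : ∫⁻ p in A, fibreVolume W p ^ 2 =
        ENNReal.ofReal (∫ v in A, sliceVolume L W v ^ 2) := by
      rw [hI, ENNReal.ofReal_toReal hIfin]
    rw [hIr, hshapes, ← ENNReal.ofReal_mul hI0, ← ENNReal.ofReal_mul hδn.le] at hup hlow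
    have hJr : J t A = ENNReal.ofReal (J t A).toReal :=
      (ENNReal.ofReal_toReal (ne_top_of_le_ne_top ENNReal.ofReal_ne_top hup)).symm
    change J t A ≤ _ at hup
    change _ ≤ J t A + _ at hlow
    have hlow' := hlow.trans (add_le_add le_rfl (mul_le_mul_right (mul_le_mul_left
      (mul_le_mul_right hDvol (2 * (M : ℝ≥0∞))) _) _))
    have hM2 : (2 * (M : ℝ≥0∞)) = ENNReal.ofReal (2 * M) := by
      rw [ENNReal.ofReal_mul (by norm_num), ENNReal.ofReal_coe_nnreal, ENNReal.ofReal_ofNat]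
    rw [hM2, ← ENNReal.ofReal_mul (by positivity), ← ENNReal.ofReal_mul (by positivity),
      ← ENNReal.ofReal_mul hδn.le, hJr, ← ENNReal.ofReal_add ENNReal.toReal_nonneg (by positivity),
      ENNReal.ofReal_le_ofReal_iff (by positivity)] at hlow'
    rw [hJr, ENNReal.ofReal_le_ofReal_iff (by positivity)] at hup
    have hpos : 0 < crossingConst L * δ t ^ (2 * d + 2) := by positivity
    rw [abs_le]
    constructor
    · have h1 : (∫ v in A, sliceVolume L W v ^ 2) - 2 * M * C * δ t ≤
          (J t A).toReal / (crossingConst L * δ t ^ (2 * d + 2)) := by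
        rw [le_div_iff₀ hpos]
        linarith
      change -(2 * M * C * δ t) ≤ _
      linarith
    · have h1 : (J t A).toReal / (crossingConst L * δ t ^ (2 * d + 2)) ≤
          ∫ v in A, sliceVolume L W v ^ 2 := by
        rw [div_le_iff₀ hpos]
        linarith
      have h2 : 0 ≤ 2 * M * C * δ t := by positivity
      linarith
  · intro t ht Ω _ P _ V hV A hA
    have hδ := hδpos t ht
    obtain ⟨hmeas, hint⟩ := intensity_crossingProcess (by rw [hWvol]; exact ENNReal.one_ne_top)
      (by omega) hV hL φ (δ t) hA
    have hJ : J t A ≠ ∞ := by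
      obtain ⟨D, hDm, -, hD⟩ := hC (δ t) hδ
      refine ne_top_of_le_ne_top ?_ (volume_crossingSet_bounds hL φ hWconv hWm hDm hδ hD hM hA).1
      exact ENNReal.mul_ne_top ENNReal.ofReal_ne_top (ENNReal.mul_ne_top
        (ne_top_of_le_ne_top (by rw [hWvol]; finiteness) (setLIntegral_fibreVolume_sq_le hWm hM A))
        (isCompact_crossingShapes L).measure_ne_top)
    refine ⟨hmeas, ?_, ?_⟩
    · rw [hint]
      exact ENNReal.mul_ne_top (by simp) (ENNReal.mul_ne_top (by simp) hJ)
    · rw [hint, ENNReal.toReal_mul, ENNReal.toReal_mul, ENNReal.toReal_pow,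
        ENNReal.toReal_ofReal ht.le, add_sub_cancel]
      change _ * (_ * (J t A).toReal) = _
      have h1 : δ t ^ (2 * d + 2) ≠ 0 := by positivity
      rw [ENNReal.toReal_inv, ENNReal.toReal_ofNat]
      field_simp
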